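/- **Setting.** There are $n$ players with actions $x^i\in\mathbb R^d$; write $x=[x^1,\dots,x^n]\in\mathbb R^{nd}$ and let $\|\cdot\|$ be the Euclidean norm. Player $i$ has the cost $J_i(x)=\tfrac12 x^\top Q_i x+r_i^\top x+k_i$ with $Q_i$ symmetric, $r_i=[r_i^1,\dots,r_i^n]\in\mathbb R^{nd}$ and $k_i\in\mathbb R$, such that $J_i$ is convex in $x^i$ for every fixed $x^{-i}$. Player $i$'s action must satisfy the individual coupling constraint $A_ix=b_i$, where $A_i\in\mathbb R^{m_i\times nd}$ and $b_i\in\mathbb R^{m_i}$. A *generalized Nash equilibrium* (GNE) is a joint action $x^*$ with $A_ix^*=b_i$ for all $i$ and $J_i(x^*)\le J_i(y,x^{*,-i})$ for all $i$ and all $y\in\mathbb R^d$ for which $(y,x^{*,-i})$ satisfies player $i$'s constraint. Assume that a GNE exists. Let $H_i\in\mathbb R^{d\times nd}$ be the $i$-th block of $d$ rows of $Q_i$, let $A_{i(i)}\in\mathbb R^{m_i\times d}$ be the $i$-th block of $d$ columns of $A_i$, and for $\lambda=[\lambda^1,\dots,\lambda^n]$ with $\lambda^i\in\mathbb R^{m_i}$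 let $$F(x,\lambda)=\sum_{i=1}^n\Big(\|H_ix+r_i^i+A_{i(i)}^\top\lambda^i\|^2+c_i(x)\Big),\qquad c_i(x)=\|A_ix-b_i\|^2 .$$ Then $F(z)=\|Gz+e\|^2$ for $z=[x,\lambda]$, where $$G=\begin{bmatrix}\operatorname{col}(H_i)_i&\operatorname{blkdiag}(A_{i(i)}^\top)_i\\ \operatorname{col}(A_i)_i&0\end{bmatrix},\qquad e=[r_1^1,\dots,r_n^n,-b_1,\dots,-b_n].$$ Put $\mu_F=2\,(\sigma^+_{\min}(G))^2$, where $\sigma^+_{\min}(G)$ is the smallest positive singular value of $G$ (if $G=0$, read $1/\mu_F$ as $0$). Let $L_i(x,\lambda^i)=J_i(x)+\langle\lambda^i,A_ix-b_i\rangle$. **Algorithm.** Fix $\sigma,\delta>0$, $g>1/\mu_F$ and $\gamma_t=g/t$, and start from arbitrary deterministic $x(1),\lambda(1)$. For $t=1,2,\dots$ let $\xi_x^i(t),\eta^i(t)\sim\mathcal N(0,I_d)$ and $\xi_\lambda^i(t)\sim\mathcal N(0,I_{m_i})$, all independent (over $i$, $t$ and kind). With $x,\lambda,\xi_x,\xi_\lambda,\eta$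 taken at time $t$, set $$\Delta_1^{(i)}=\frac{L_i(x+\sigma\eta,\lambda^i)-L_i(x-\sigma\eta,\lambda^i)}{2\sigma},\qquad \Delta_2^{(i)}=\frac{L_i(x+\delta\xi_x+\sigma\eta,\lambda^i+\delta\xi_\lambda^i)-L_i(x+\delta\xi_x-\sigma\eta,\lambda^i+\delta\xi^i_\lambda)}{2\sigma},$$ $$\Delta_3^{(i)}=\frac{c_i(x+\sigma\eta)-c_i(x-\sigma\eta)}{2\sigma},\qquad S_1^{(i)}=\frac{(\Delta_2^{(i)})^2-(\Delta_1^{(i)})^2}{\delta},\qquad S_2^{(i)}=S_1^{(i)}\|\eta^i\|^2,$$ $$S=\tfrac12\sum_{j=1}^n\big(S_2^{(j)}-dS_1^{(j)}\big),\qquad D=\sum_{j=1}^n\Delta_3^{(j)},$$ and update, for every $i$, $$x^i(t+1)=x^i(t)-\gamma_t\big(S\,\xi_x^i+D\,\eta^i\big),\qquad \lambda^i(t+1)=\lambda^i(t)-\gamma_t\cdot\tfrac12\big(S_2^{(i)}-dS_1^{(i)}\big)\xi_\lambda^i .$$ **Theorem.** Under these assumptions there is a random vector $x_\infty$ that is almost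 surely a GNE and such that $x(t)\to x_\infty$ almost surely. Moreover $F(x(t),\lambda(t))$ is integrable for every $t\ge1$, and $\mathbb E\,F(x(t),\lambda(t))$ converges to $0$ with $\mathbb E\,F(x(t),\lambda(t))=O(1/t)$ as $t\to\infty$. -/

import Mathlib

open MeasureTheory ProbabilityTheory Filter Asymptotics
open scoped Topology RealInnerProductSpace Matrix

noncomputable section

namespace ZeroOrderGNE

/-- A joint action: one block in `ℝ^d` (Euclidean norm) for each of the `n` players. -/
abbrev Action (n d : ℕ) := Fin n → EuclideanSpace ℝ (Fin d)

/-- The dual variables: one block in `ℝ^(m i)` for each player `i`. -/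
abbrev DualVars {n : ℕ} (m : Fin n → ℕ) := ∀ i, EuclideanSpace ℝ (Fin (m i))

/-- The vector of `ℝ^(nd)` with the given blocks. -/
def flat {n d : ℕ} (x : Action n d) : Fin n × Fin d → ℝ := fun p => x p.1 p.2

/-- The data of a game with `n` players, actions in `ℝ^d`, quadratic costs and individual linear
equality constraints: the cost of player `i` is `½ xᵀ Q_i x + r_iᵀ x + k_i` and the constraint of
player `i` is `A_i x = b_i`, with `m i` rows. -/
structure QuadGame (n d : ℕ) (m : Fin n → ℕ) where
  Q : Fin n → Matrix (Fin n × Fin d) (Fin n × Fin d) ℝ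
  r : Fin n → (Fin n × Fin d → ℝ)
  k : Fin n → ℝ
  A : ∀ i, Matrix (Fin (m i)) (Fin n × Fin d) ℝ
  b : ∀ i, Fin (m i) → ℝ

namespace QuadGame

variable {n d : ℕ} {m : Fin n → ℕ} (Γ : QuadGame n d m)

/-- The cost function `J_i`. -/
def cost (i : Fin n) (x : Action n d) : ℝ :=
  (1 / 2) * (flat x ⬝ᵥ (Γ.Q i *ᵥ flat x)) + Γ.r i ⬝ᵥ flat x + Γ.k i

/-- The constraint residual `A_i x - b_i`. -/
def residual (i : Fin n) (x : Action n d) : EuclideanSpace ℝ (Fin (m i)) :=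
  WithLp.toLp 2 (Γ.A i *ᵥ flat x - Γ.b i)

/-- The coupled action set `C_i(x^{-i})`; the block `x i` plays no role. -/
def feasibleSet (i : Fin n) (x : Action n d) : Set (EuclideanSpace ℝ (Fin d)) :=
  {y | Γ.residual i (Function.update x i y) = 0}

/-- The matrices `Q_i` are symmetric and each cost `J_i` is convex in player `i`'s own action. -/
structure Standing : Prop where
  symm : ∀ i, (Γ.Q i).IsSymm
  convex : ∀ i (x : Action n d), ConvexOn ℝ Set.univ
    (fun y : EuclideanSpace ℝ (Fin d) => Γ.cost i (Function.update x i y))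

/-- Generalized Nash equilibrium. -/
def IsGNE (x : Action n d) : Prop :=
  (∀ i, x i ∈ Γ.feasibleSet i x) ∧
    ∀ i, ∀ y ∈ Γ.feasibleSet i x, Γ.cost i x ≤ Γ.cost i (Function.update x i y)

/-- The block row `H_i = ½ [Q_i + Q_iᵀ]_{(i,:)}`, a `d × nd` matrix. -/
def H (i : Fin n) : Matrix (Fin d) (Fin n × Fin d) ℝ :=
  Matrix.of fun a q => (1 / 2) * (Γ.Q i + (Γ.Q i)ᵀ) (i, a) q

/-- The transpose of the `i`-th block of `d` columns of `A_i`, a `d × m_i` matrix. -/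
def Aown (i : Fin n) : Matrix (Fin d) (Fin (m i)) ℝ :=
  Matrix.of fun a l => Γ.A i l (i, a)

/-- `h_i(x, λ^i) = ‖H_i x + r_i^i + A_{i(i,:)}ᵀ λ^i‖²`. -/
def h (i : Fin n) (x : Action n d) (l : EuclideanSpace ℝ (Fin (m i))) : ℝ :=
  ‖(WithLp.toLp 2 (Γ.H i *ᵥ flat x + (fun a => Γ.r i (i, a)) + Γ.Aown i *ᵥ l.ofLp) :
    EuclideanSpace ℝ (Fin d))‖ ^ 2

/-- `c_i(x) = ‖A_i x - b_i‖²`. -/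
def c (i : Fin n) (x : Action n d) : ℝ := ‖Γ.residual i x‖ ^ 2

/-- The gap function `F(x, λ)`. -/
def gap (x : Action n d) (l : DualVars m) : ℝ := ∑ i, (Γ.h i x (l i) + Γ.c i x)

/-- The matrix `G` with `F(z) = ‖G z + e‖²`, in blocks: the `H_i` stacked, the block diagonal matrix
of the `A_{i(i,:)}ᵀ`, the `A_i` stacked, and zero. -/
def G : Matrix ((Fin n × Fin d) ⊕ (Σ i, Fin (m i))) ((Fin n × Fin d) ⊕ (Σ i, Fin (m i))) ℝ :=
  Matrix.fromBlocks
    (Matrix.of fun p q => Γ.H p.1 p.2 q)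
    (Matrix.of fun p s => if s.1 = p.1 then Γ.Aown s.1 p.2 s.2 else 0)
    (Matrix.of fun s q => Γ.A s.1 s.2 q)
    0

/-- The smallest positive singular value of `G`. If `G = 0` there is none, and the value is `0`. -/
def sigmaMinPos : ℝ :=
  sInf {s | 0 < s ∧ s ∈ Set.range (Matrix.toEuclideanLin Γ.G).singularValues}

/-- The Polyak–Łojasiewicz constant `μ_F = 2 (σ_min⁺(G))²`. -/
def muF : ℝ := 2 * Γ.sigmaMinPos ^ 2

/-- The local Lagrangian `L_i(x, λ^i) = J_i(x) + ⟨λ^i, A_i x - b_i⟩`. -/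
def lagrangian (i : Fin n) (x : Action n d) (l : EuclideanSpace ℝ (Fin (m i))) : ℝ :=
  Γ.cost i x + ⟪l, Γ.residual i x⟫

/-! The quantities of one step of the scheme, at the current point `(x, l)`, with directions
`ξ` (for the actions), `ν` (for the dual variables) and `η`. Only values of the Lagrangians and of
the residuals at the four query points enter. -/

/-- `Δ_1^{(i)}`, from the query points `(x ∓ σ η, λ^i)`. -/
def Delta1 (σ : ℝ) (x : Action n d) (l : DualVars m) (η : Action n d) (i : Fin n) : ℝ :=
  (Γ.lagrangian i (x + σ • η) (l i) - Γ.lagrangian i (x - σ • η) (l i)) / (2 * σ)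

/-- `Δ_2^{(i)}`, from the query points `(x + δ ξ ∓ σ η, λ^i + δ ν^i)`. -/
def Delta2 (σ δ : ℝ) (x : Action n d) (l : DualVars m) (ξ : Action n d) (ν : DualVars m)
    (η : Action n d) (i : Fin n) : ℝ :=
  (Γ.lagrangian i (x + δ • ξ + σ • η) (l i + δ • ν i)
    - Γ.lagrangian i (x + δ • ξ - σ • η) (l i + δ • ν i)) / (2 * σ)

/-- `Δ_3^{(i)}`. -/
def Delta3 (σ : ℝ) (x : Action n d) (η : Action n d) (i : Fin n) : ℝ :=
  (Γ.c i (x + σ • η) - Γ.c i (x - σ • η)) / (2 * σ)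

/-- `S_1^{(i)}`. -/
def S1 (σ δ : ℝ) (x : Action n d) (l : DualVars m) (ξ : Action n d) (ν : DualVars m)
    (η : Action n d) (i : Fin n) : ℝ :=
  (Γ.Delta2 σ δ x l ξ ν η i ^ 2 - Γ.Delta1 σ x l η i ^ 2) / δ

/-- `S_2^{(i)}`. -/
def S2 (σ δ : ℝ) (x : Action n d) (l : DualVars m) (ξ : Action n d) (ν : DualVars m)
    (η : Action n d) (i : Fin n) : ℝ :=
  Γ.S1 σ δ x l ξ ν η i * ‖η i‖ ^ 2

/-- The message `½ (S_2^{(i)} - d S_1^{(i)})` of player `i` to the aggregator. -/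
def message (σ δ : ℝ) (x : Action n d) (l : DualVars m) (ξ : Action n d) (ν : DualVars m)
    (η : Action n d) (i : Fin n) : ℝ :=
  (1 / 2) * (Γ.S2 σ δ x l ξ ν η i - (d : ℝ) * Γ.S1 σ δ x l ξ ν η i)

/-- The gradient estimate for the action of player `i`, namely `S ξ^i + D η^i`, where `S` and `D`
are the sums that the aggregator broadcasts. -/
def zetaX (σ δ : ℝ) (x : Action n d) (l : DualVars m) (ξ : Action n d) (ν : DualVars m)
    (η : Action n d) (i : Fin n) : EuclideanSpace ℝ (Fin d) :=
  (∑ j, Γ.message σ δ x l ξ ν η j) • ξ i + (∑ j, Γ.Delta3 σ x η j) • η i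

/-- The gradient estimate for the dual variable of player `i`. -/
def zetaDual (σ δ : ℝ) (x : Action n d) (l : DualVars m) (ξ : Action n d) (ν : DualVars m)
    (η : Action n d) (i : Fin n) : EuclideanSpace ℝ (Fin (m i)) :=
  Γ.message σ δ x l ξ ν η i • ν i

end QuadGame

/-- Labels of the random directions: at each time `t` every player `i` draws a direction for the
action, one for the dual variable, and the direction `η^i`. -/
inductive NoiseLabel (n : ℕ) where
  | xi (t : ℕ) (i : Fin n)
  | nu (t : ℕ) (i : Fin n)
  | eta (t : ℕ) (i : Fin n)

/-- The dimension of the direction with a given label. -/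
def NoiseLabel.dim {n : ℕ} (d : ℕ) (m : Fin n → ℕ) : NoiseLabel n → ℕ
  | .xi _ _ => d
  | .nu _ i => m i
  | .eta _ _ => d

/-- All random directions are standard Gaussian vectors, jointly independent over times, players
and kinds. -/
structure IsGaussianNoise {n d : ℕ} {m : Fin n → ℕ} {Ω : Type*} [MeasurableSpace Ω]
    (w : ∀ a : NoiseLabel n, Ω → EuclideanSpace ℝ (Fin (a.dim d m))) (P : Measure Ω) : Prop where
  law : ∀ a, HasLaw (w a) (stdGaussian (EuclideanSpace ℝ (Fin (a.dim d m)))) P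
  indep : iIndepFun w P

/-- `x, l` are the iterates of the zero-order scheme, driven by the directions `w`, with parameters
`σ, δ` and step sizes `γ t`. The iteration runs over `t = 1, 2, …` and starts at `(x₀, l₀)`. -/
structure IsZeroOrderRun {n d : ℕ} {m : Fin n → ℕ} {Ω : Type*} (Γ : QuadGame n d m) (σ δ : ℝ)
    (γ : ℕ → ℝ) (w : ∀ a : NoiseLabel n, Ω → EuclideanSpace ℝ (Fin (a.dim d m)))
    (x₀ : Action n d) (l₀ : DualVars m) (x : ℕ → Ω → Action n d) (l : ℕ → Ω → DualVars m) : Prop where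
  init_x : ∀ ω, x 1 ω = x₀
  init_l : ∀ ω, l 1 ω = l₀
  step_x : ∀ t, 1 ≤ t → ∀ ω i, x (t + 1) ω i = x t ω i - γ t •
    Γ.zetaX σ δ (x t ω) (l t ω) (fun j => w (.xi t j) ω) (fun j => w (.nu t j) ω)
      (fun j => w (.eta t j) ω) i
  step_l : ∀ t, 1 ≤ t → ∀ ω i, l (t + 1) ω i = l t ω i - γ t •
    Γ.zetaDual σ δ (x t ω) (l t ω) (fun j => w (.xi t j) ω) (fun j => w (.nu t j) ω)
      (fun j => w (.eta t j) ω) i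

end ZeroOrderGNE

end

/-!
With `z = [x, λ]`, the gap function is `F(z) = ‖G z + e‖²`. For a game with convex costs and linear
constraints its zeros are the pairs of an equilibrium and its multipliers
(`Standing.isGNE_of_eq_zero`, `Standing.exists_multipliers`), so it suffices to show that the
iterates converge to a zero of `F`.

Fix a zero `z*`. Central differences of quadratic functions are exact, so the update direction is a
polynomial in the Gaussian directions that is affine in `z` (`Standing.Delta1_eq`,
`Standing.joint_zeta_eq`). Second, third and fourth Gaussian moments show that it is an unbiased
estimate of `∇F`: the weight `‖η^j‖² - d` filters the own block of the gradient of the Lagrangian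
out of the full one, and the contribution of order `δ` is odd in `[ξ, ν]`
(`Standing.integral_linEst`, `integral_quadEst`). Hence `D_t = z_t - z*` satisfies a linear
recursion `D_{t+1} = D_t - γ_t (s_t + R_t D_t)` whose coefficients are independent of the past,
square integrable and of means `0` and `2 Gᵀ G` (`IsLinearRecursion`,
`IsZeroOrderRun.exists_isLinearRecursion`).

For such a recursion, the variance of the noise is controlled by `1 + E ‖D_t‖²` only, not by the
gap, because the full gradients of the Lagrangians enter the estimate. Since the steps are square
summable, `E ‖D_t‖²` nevertheless remains bounded (`exists_second_moment_le`). The gap then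
satisfies `E F_{t+1} ≤ (1 - 4 ρ g / t) E F_t + O(1/t²)`, where `ρ = σ_min⁺(G)²` comes from the
Polyak–Łojasiewicz inequality `ρ ‖G v‖² ≤ ‖Gᵀ G v‖²` (`exists_pl_constant`) and `4 ρ g > 1`. By
Chung's lemma `E F_t = O(1/t)` (`exists_gap_le`).

For the almost sure convergence (`ae_exists_tendsto`), `D_t` is split into the drift `∑ γ_k 2 Gᵀ G
D_k`, which converges absolutely because the `k`-th term has mean of order `k⁻¹ √(E F_k) =
O(k^(-3/2))`, and the martingale of the accumulated noise, which is bounded in `L¹` because the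
drift and `D_t` are. By Fatou's lemma the limit is a zero of the gap.
-/

namespace ZeroOrderGNE

/-! ### Numerical recursions and elementary estimates -/

lemma sum_inv_succ_sq_le (t : ℕ) :
    ∑ k ∈ Finset.range t, 1 / ((k : ℝ) + 1) ^ 2 ≤ 2 := by
  have key : ∀ t : ℕ, ∑ k ∈ Finset.range (t + 1), 1 / ((k : ℝ) + 1) ^ 2
      ≤ 2 - 1 / ((t : ℝ) + 1) := by
    intro t
    induction t with
    | zero => norm_num
    | succ t ih =>
      rw [Finset.sum_range_succ]
      have h1 : (0 : ℝ) < (t : ℝ) + 1 := by positivity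
      have h2 : 1 / (((t + 1 : ℕ) : ℝ) + 1) ^ 2
          ≤ 1 / ((t : ℝ) + 1) - 1 / (((t + 1 : ℕ) : ℝ) + 1) := by
        push_cast
        rw [div_sub_div _ _ (by positivity) (by positivity), div_le_div_iff₀ (by positivity)
          (by positivity)]
        nlinarith
      linarith
  rcases t with _ | t
  · simp
  · have h1 : (0 : ℝ) ≤ 1 / ((t : ℝ) + 1) := by positivity
    linarith [key t]

/-- A discrete Grönwall inequality with square-summable rates. -/
lemma bounded_of_recursion {u : ℕ → ℝ} {C : ℝ} (hC : 0 ≤ C) (hu : ∀ t, 0 ≤ u t)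
    (h : ∀ t : ℕ, u (t + 1) ≤ (1 + C / ((t : ℝ) + 1) ^ 2) * u t + C / ((t : ℝ) + 1) ^ 2) :
    ∃ B, ∀ t, u t ≤ B := by
  have key : ∀ t : ℕ, 1 + u t
      ≤ Real.exp (C * ∑ k ∈ Finset.range t, 1 / ((k : ℝ) + 1) ^ 2) * (1 + u 0) := by
    intro t
    induction t with
    | zero => simp
    | succ t ih =>
      have h0 : 0 ≤ C / ((t : ℝ) + 1) ^ 2 := by positivity
      have h1 : 1 + u (t + 1) ≤ (1 + C / ((t : ℝ) + 1) ^ 2) * (1 + u t) := by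
        have := h t
        nlinarith [hu t]
      have h2 : 1 + C / ((t : ℝ) + 1) ^ 2 ≤ Real.exp (C / ((t : ℝ) + 1) ^ 2) := by
        linarith [Real.add_one_le_exp (C / ((t : ℝ) + 1) ^ 2)]
      rw [Finset.sum_range_succ, mul_add C, Real.exp_add]
      calc 1 + u (t + 1) ≤ (1 + C / ((t : ℝ) + 1) ^ 2) * (1 + u t) := h1
        _ ≤ Real.exp (C / ((t : ℝ) + 1) ^ 2) * (1 + u t) :=
          mul_le_mul_of_nonneg_right h2 (by linarith [hu t])
        _ ≤ Real.exp (C / ((t : ℝ) + 1) ^ 2) *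
            (Real.exp (C * ∑ k ∈ Finset.range t, 1 / ((k : ℝ) + 1) ^ 2) * (1 + u 0)) :=
          mul_le_mul_of_nonneg_left ih (Real.exp_nonneg _)
        _ = _ := by rw [mul_one_div]; ring
  refine ⟨Real.exp (C * 2) * (1 + u 0), fun t => ?_⟩
  have h1 : Real.exp (C * ∑ k ∈ Finset.range t, 1 / ((k : ℝ) + 1) ^ 2) ≤ Real.exp (C * 2) :=
    Real.exp_le_exp.2 (mul_le_mul_of_nonneg_left (sum_inv_succ_sq_le t) hC)
  have := mul_le_mul_of_nonneg_right h1 (by linarith [hu 0] : 0 ≤ 1 + u 0)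
  linarith [key t]

/-- Chung's lemma: contraction by `1 - α / t` with `α > 1` against errors of order `1 / t²` gives
the rate `1 / t`. -/
lemma rate_of_recursion {v : ℕ → ℝ} {α C : ℝ} (hα : 1 < α) (hC : 0 ≤ C) (hv : ∀ t, 0 ≤ v t)
    (h : ∀ t : ℕ, v (t + 1) ≤ (1 - α / ((t : ℝ) + 1)) * v t + C / ((t : ℝ) + 1) ^ 2) :
    ∃ B, 0 ≤ B ∧ ∀ t : ℕ, v t ≤ B / ((t : ℝ) + 1) := by
  obtain ⟨T, hT⟩ := exists_nat_gt α
  have hT0 : 1 ≤ T := by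
    have : (0 : ℝ) < T := by linarith
    exact_mod_cast this
  -- From time `T ≥ α` on, the bound `B / t` is preserved as soon as `B ≥ C / (α - 1)`.
  set B : ℝ := C / (α - 1) + ∑ k ∈ Finset.range (T + 1), ((k : ℝ) + 1) * v k with hB
  have hsum : ∀ k ∈ Finset.range (T + 1), 0 ≤ ((k : ℝ) + 1) * v k := fun k _ =>
    mul_nonneg (by positivity) (hv k)
  have hCB : 0 ≤ C / (α - 1) := div_nonneg hC (by linarith)
  have hB0 : 0 ≤ B := add_nonneg hCB (Finset.sum_nonneg hsum)
  have hsmall : ∀ t, t ≤ T → ((t : ℝ) + 1) * v t ≤ B := by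
    intro t ht
    have := Finset.single_le_sum hsum (Finset.mem_range.2 (by omega : t < T + 1))
    linarith
  have hlarge : ∀ t : ℕ, T ≤ t → (t : ℝ) * v t ≤ B := by
    intro t ht
    induction t, ht using Nat.le_induction with
    | base => nlinarith [hsmall T le_rfl, hv T]
    | succ t ht ih =>
      have htT : (T : ℝ) ≤ t := by exact_mod_cast ht
      have ht0 : (0 : ℝ) < t := by linarith
      have h1 : (0 : ℝ) < (t : ℝ) + 1 := by linarith
      have hb : C ≤ (α - 1) * B := by
        have : C / (α - 1) ≤ B := by linarith [Finset.sum_nonneg hsum]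
        rw [div_le_iff₀ (by linarith)] at this
        linarith
      have hvt : v t ≤ B / t := by rw [le_div_iff₀ ht0]; linarith
      have hf : 0 ≤ 1 - α / ((t : ℝ) + 1) := by
        rw [sub_nonneg, div_le_one h1]; linarith
      have h2 : v (t + 1) ≤ (1 - α / ((t : ℝ) + 1)) * (B / t) + C / ((t : ℝ) + 1) ^ 2 :=
        (h t).trans (by linarith [mul_le_mul_of_nonneg_left hvt hf])
      have h3 : ((t : ℝ) + 1) * ((1 - α / ((t : ℝ) + 1)) * (B / t) + C / ((t : ℝ) + 1) ^ 2)
          = B - ((α - 1) * B / t - C / ((t : ℝ) + 1)) := by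
        field_simp; ring
      have h4 : C / ((t : ℝ) + 1) ≤ (α - 1) * B / t := by
        rw [div_le_div_iff₀ h1 ht0]; nlinarith
      push_cast
      have := mul_le_mul_of_nonneg_left h2 h1.le
      linarith
  refine ⟨2 * B, by linarith, fun t => ?_⟩
  rw [le_div_iff₀ (by positivity)]
  rcases le_total t T with ht | ht
  · linarith [hsmall t ht]
  · have h1 : (1 : ℝ) ≤ t := by exact_mod_cast hT0.trans ht
    nlinarith [hlarge t ht, hv t]

lemma real_dotProduct_self_nonneg {ι : Type*} [Fintype ι] (v : ι → ℝ) : 0 ≤ v ⬝ᵥ v :=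
  Finset.sum_nonneg fun _ _ => mul_self_nonneg _

lemma sq_dotProduct_le {ι : Type*} [Fintype ι] (v w : ι → ℝ) :
    (v ⬝ᵥ w) ^ 2 ≤ (v ⬝ᵥ v) * (w ⬝ᵥ w) := by
  have := Finset.sum_mul_sq_le_sq_mul_sq Finset.univ v w
  simpa [dotProduct, sq] using this

lemma exists_mulVec_sq_le {ι κ : Type*} [Fintype ι] [Fintype κ] (N : Matrix κ ι ℝ) :
    ∃ C, 0 ≤ C ∧ ∀ v : ι → ℝ, (N *ᵥ v) ⬝ᵥ (N *ᵥ v) ≤ C * (v ⬝ᵥ v) := by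
  refine ⟨∑ k, N k ⬝ᵥ N k, Finset.sum_nonneg fun _ _ => real_dotProduct_self_nonneg _, fun v => ?_⟩
  rw [dotProduct, Finset.sum_mul]
  exact Finset.sum_le_sum fun k _ => by
    rw [← sq]; exact sq_dotProduct_le _ _

/-- One gradient step on `‖G v‖²` enlarges `‖v‖²` at most by a factor `1 + O(γ²)`. -/
lemma exists_gradient_step_sq_le {ι κ : Type*} [Fintype ι] [Fintype κ] [DecidableEq ι]
    (G : Matrix κ ι ℝ) :
    ∃ C, 0 ≤ C ∧ ∀ γ : ℝ, 0 ≤ γ → ∀ v : ι → ℝ,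
      (v - γ • ((2 • (Gᵀ * G)) *ᵥ v)) ⬝ᵥ (v - γ • ((2 • (Gᵀ * G)) *ᵥ v))
        ≤ (1 + γ ^ 2 * C) * (v ⬝ᵥ v) := by
  obtain ⟨C, hC, h⟩ := exists_mulVec_sq_le (2 • (Gᵀ * G))
  refine ⟨C, hC, fun γ hγ v => ?_⟩
  have h1 : v ⬝ᵥ ((2 • (Gᵀ * G)) *ᵥ v) = 2 * ((G *ᵥ v) ⬝ᵥ (G *ᵥ v)) := by
    rw [Matrix.smul_mulVec, dotProduct_smul, ← Matrix.mulVec_mulVec, Matrix.dotProduct_mulVec,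
      Matrix.vecMul_transpose]
    simp
  have h2 := real_dotProduct_self_nonneg (G *ᵥ v)
  have h3 := mul_le_mul_of_nonneg_left (h v) (sq_nonneg γ)
  simp only [sub_dotProduct, dotProduct_sub, smul_dotProduct, dotProduct_smul, smul_eq_mul,
    dotProduct_comm ((2 • (Gᵀ * G)) *ᵥ v) v, h1]
  nlinarith [mul_nonneg hγ h2]

/-- One gradient step contracts `‖G v‖²` if `Gᵀ` is bounded below on the range of `G`
(a Polyak–Łojasiewicz inequality). -/
lemma exists_gradient_step_gap_le {ι κ : Type*} [Fintype ι] [Fintype κ] [DecidableEq ι]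
    (G : Matrix κ ι ℝ) {ρ : ℝ}
    (hρ : ∀ v, ρ * ((G *ᵥ v) ⬝ᵥ (G *ᵥ v)) ≤ (Gᵀ *ᵥ (G *ᵥ v)) ⬝ᵥ (Gᵀ *ᵥ (G *ᵥ v))) :
    ∃ C, 0 ≤ C ∧ ∀ γ : ℝ, 0 ≤ γ → ∀ v : ι → ℝ,
      (G *ᵥ (v - γ • ((2 • (Gᵀ * G)) *ᵥ v))) ⬝ᵥ (G *ᵥ (v - γ • ((2 • (Gᵀ * G)) *ᵥ v)))
        ≤ (1 - 4 * ρ * γ) * ((G *ᵥ v) ⬝ᵥ (G *ᵥ v)) + γ ^ 2 * C * (v ⬝ᵥ v) := by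
  obtain ⟨C, hC, h⟩ := exists_mulVec_sq_le (G * (2 • (Gᵀ * G)))
  refine ⟨C, hC, fun γ hγ v => ?_⟩
  have h1 : (G *ᵥ v) ⬝ᵥ ((G * (2 • (Gᵀ * G))) *ᵥ v)
      = 2 * ((Gᵀ *ᵥ (G *ᵥ v)) ⬝ᵥ (Gᵀ *ᵥ (G *ᵥ v))) := by
    rw [Matrix.mul_smul, Matrix.smul_mulVec, dotProduct_smul, ← Matrix.mulVec_mulVec,
      ← Matrix.mulVec_mulVec, Matrix.dotProduct_mulVec, ← Matrix.mulVec_transpose]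
    simp
  have h3 := mul_le_mul_of_nonneg_left (h v) (sq_nonneg γ)
  have h4 := mul_le_mul_of_nonneg_left (hρ v) hγ
  rw [Matrix.mulVec_sub, Matrix.mulVec_smul, Matrix.mulVec_mulVec]
  simp only [sub_dotProduct, dotProduct_sub, smul_dotProduct, dotProduct_smul, smul_eq_mul,
    dotProduct_comm ((G * (2 • (Gᵀ * G))) *ᵥ v) (G *ᵥ v), h1]
  nlinarith

/-! ### Products of independent square-integrable variables -/

section Indep

variable {Ω : Type*} {𝒢 ℱ mΩ : MeasurableSpace Ω} {P : Measure Ω}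

lemma integrable_fun_mul {X Y : Ω → ℝ} (hX : MemLp X 2 P) (hY : MemLp Y 2 P) :
    Integrable (fun ω => X ω * Y ω) P := hX.integrable_mul hY

lemma indepFun_of_indep (h : Indep 𝒢 ℱ P) {X Y : Ω → ℝ} (hX : Measurable[𝒢] X)
    (hY : Measurable[ℱ] Y) : IndepFun X Y P :=
  (IndepFun_iff_Indep X Y P).2
    (indep_of_indep_of_le_left (indep_of_indep_of_le_right h hY.comap_le) hX.comap_le)

lemma memLp_mul_of_indep (h : Indep 𝒢 ℱ P) {X Y : Ω → ℝ} (hX : Measurable[𝒢] X)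
    (hY : Measurable[ℱ] Y) (hX2 : MemLp X 2 P) (hY2 : MemLp Y 2 P) :
    MemLp (fun ω => X ω * Y ω) 2 P := by
  refine (memLp_two_iff_integrable_sq (hX2.1.mul hY2.1)).2 ?_
  have h1 := (indepFun_of_indep h (hX.pow_const 2) (hY.pow_const 2)).integrable_mul
    hX2.integrable_sq hY2.integrable_sq
  refine h1.congr (Eventually.of_forall fun ω => ?_)
  simp [mul_pow]

lemma integral_mul_sq_of_indep (h : Indep 𝒢 ℱ P) {X Y : Ω → ℝ} (hX : Measurable[𝒢] X)
    (hY : Measurable[ℱ] Y) (hX2 : MemLp X 2 P) (hY2 : MemLp Y 2 P) :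
    ∫ ω, (X ω * Y ω) ^ 2 ∂P = (∫ ω, X ω ^ 2 ∂P) * ∫ ω, Y ω ^ 2 ∂P := by
  simp_rw [mul_pow]
  exact (indepFun_of_indep h (hX.pow_const 2) (hY.pow_const 2)).integral_fun_mul_eq_mul_integral
    hX2.integrable_sq.1 hY2.integrable_sq.1

end Indep

/-! ### Linear recursions with random coefficients -/

/-- A linear stochastic recursion `D_{t+1} = D_t - γ_t (s_t + R_t D_t)` in `ℝ^ι`, whose random
coefficients `s_t, R_t` are measurable for `𝒢 t`, hence independent of the past `ℱ t`, have means
`0` and `M`, and uniformly bounded variances. -/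
structure IsLinearRecursion {ι Ω : Type*} [Fintype ι] {mΩ : MeasurableSpace Ω} (P : Measure Ω)
    (ℱ : Filtration ℕ mΩ) (𝒢 : ℕ → MeasurableSpace Ω) (M : Matrix ι ι ℝ) (K : ℝ) (γ : ℕ → ℝ)
    (s : ℕ → ι → Ω → ℝ) (R : ℕ → ι → ι → Ω → ℝ) (D : ℕ → Ω → ι → ℝ) : Prop where
  indep : ∀ t, Indep (𝒢 t) (ℱ t) P
  le_succ : ∀ t, 𝒢 t ≤ ℱ (t + 1)
  measurable_s : ∀ t a, Measurable[𝒢 t] (s t a)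
  measurable_R : ∀ t a b, Measurable[𝒢 t] (R t a b)
  memLp_s : ∀ t a, MemLp (s t a) 2 P
  memLp_R : ∀ t a b, MemLp (R t a b) 2 P
  integral_s : ∀ t a, ∫ ω, s t a ω ∂P = 0
  integral_R : ∀ t a b, ∫ ω, R t a b ω ∂P = M a b
  sq_s_le : ∀ t a, ∫ ω, s t a ω ^ 2 ∂P ≤ K
  sq_R_le : ∀ t a b, ∫ ω, (R t a b ω - M a b) ^ 2 ∂P ≤ K
  init : ∃ v, ∀ ω, D 0 ω = v
  step : ∀ t ω a, D (t + 1) ω a = D t ω a - γ t * (s t a ω + ∑ b, R t a b ω * D t ω b)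

namespace IsLinearRecursion

variable {ι Ω : Type*} [Fintype ι] {mΩ : MeasurableSpace Ω} {P : Measure Ω}
  [IsProbabilityMeasure P] {ℱ : Filtration ℕ mΩ} {𝒢 : ℕ → MeasurableSpace Ω}
  {M : Matrix ι ι ℝ} {K : ℝ} {γ : ℕ → ℝ} {s : ℕ → ι → Ω → ℝ} {R : ℕ → ι → ι → Ω → ℝ}
  {D : ℕ → Ω → ι → ℝ}

/-- The noise at time `t`: the increment of the recursion minus its conditional mean `M D_t`. -/
def noise (M : Matrix ι ι ℝ) (s : ℕ → ι → Ω → ℝ) (R : ℕ → ι → ι → Ω → ℝ)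
    (D : ℕ → Ω → ι → ℝ) (t : ℕ) (ω : Ω) (a : ι) : ℝ :=
  s t a ω + ∑ b, (R t a b ω - M a b) * D t ω b

lemma measurable_and_memLp (h : IsLinearRecursion P ℱ 𝒢 M K γ s R D) (t : ℕ) :
    ∀ a, Measurable[ℱ t] (fun ω => D t ω a) ∧ MemLp (fun ω => D t ω a) 2 P := by
  induction t with
  | zero =>
    intro a
    obtain ⟨v, hv⟩ := h.init
    have : (fun ω => D 0 ω a) = fun _ => v a := by funext ω; rw [hv]
    rw [this]
    exact ⟨measurable_const, memLp_const _⟩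
  | succ t ih =>
    intro a
    have hD : ∀ b, Measurable[ℱ (t + 1)] (fun ω => D t ω b) := fun b =>
      (ih b).1.mono (ℱ.mono t.le_succ) le_rfl
    have e : (fun ω => D (t + 1) ω a)
        = fun ω => D t ω a - γ t * (s t a ω + ∑ b, R t a b ω * D t ω b) :=
      funext fun ω => h.step t ω a
    rw [e]
    refine ⟨?_, ?_⟩
    · refine (hD a).sub (Measurable.const_mul (Measurable.add ?_ ?_) _)
      · exact (h.measurable_s t a).mono (h.le_succ t) le_rfl
      · exact Finset.measurable_fun_sum _ fun b _ =>
          ((h.measurable_R t a b).mono (h.le_succ t) le_rfl).mul (hD b)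
    · refine (ih a).2.sub (MemLp.const_mul ((h.memLp_s t a).add ?_) _)
      exact memLp_finsetSum _ fun b _ => memLp_mul_of_indep (h.indep t) (h.measurable_R t a b)
        (ih b).1 (h.memLp_R t a b) (ih b).2

lemma measurable (h : IsLinearRecursion P ℱ 𝒢 M K γ s R D) (t : ℕ) (a : ι) :
    Measurable[ℱ t] (fun ω => D t ω a) := (h.measurable_and_memLp t a).1

lemma memLp (h : IsLinearRecursion P ℱ 𝒢 M K γ s R D) (t : ℕ) (a : ι) :
    MemLp (fun ω => D t ω a) 2 P := (h.measurable_and_memLp t a).2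

lemma memLp_mulVec {κ : Type*} (h : IsLinearRecursion P ℱ 𝒢 M K γ s R D) (N : Matrix κ ι ℝ)
    (t : ℕ) (k : κ) : MemLp (fun ω => (N *ᵥ D t ω) k) 2 P :=
  memLp_finsetSum _ fun a _ => (h.memLp t a).const_mul (N k a)

lemma measurable_mulVec {κ : Type*} (h : IsLinearRecursion P ℱ 𝒢 M K γ s R D) (N : Matrix κ ι ℝ)
    (t : ℕ) (k : κ) : Measurable[ℱ t] (fun ω => (N *ᵥ D t ω) k) :=
  Finset.measurable_fun_sum _ fun a _ => (h.measurable t a).const_mul (N k a)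

lemma memLp_centered (h : IsLinearRecursion P ℱ 𝒢 M K γ s R D) (t : ℕ) (a b : ι) :
    MemLp (fun ω => R t a b ω - M a b) 2 P := (h.memLp_R t a b).sub (memLp_const _)

omit [IsProbabilityMeasure P] in
lemma measurable_centered (h : IsLinearRecursion P ℱ 𝒢 M K γ s R D) (t : ℕ) (a b : ι) :
    Measurable[𝒢 t] (fun ω => R t a b ω - M a b) := (h.measurable_R t a b).sub measurable_const

lemma integral_centered (h : IsLinearRecursion P ℱ 𝒢 M K γ s R D) (t : ℕ) (a b : ι) :
    ∫ ω, (R t a b ω - M a b) ∂P = 0 := by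
  rw [integral_sub ((h.memLp_R t a b).integrable (by norm_num)) (integrable_const _),
    h.integral_R]
  simp

lemma memLp_noise (h : IsLinearRecursion P ℱ 𝒢 M K γ s R D) (t : ℕ) (a : ι) :
    MemLp (fun ω => noise M s R D t ω a) 2 P :=
  (h.memLp_s t a).add <| memLp_finsetSum _ fun b _ =>
    memLp_mul_of_indep (h.indep t) (h.measurable_centered t a b) (h.measurable t b)
      (h.memLp_centered t a b) (h.memLp t b)

lemma measurable_noise (h : IsLinearRecursion P ℱ 𝒢 M K γ s R D) (t : ℕ) (a : ι) :
    Measurable[ℱ (t + 1)] (fun ω => noise M s R D t ω a) :=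
  Measurable.add ((h.measurable_s t a).mono (h.le_succ t) le_rfl) <|
    Finset.measurable_fun_sum _ fun b _ =>
      ((h.measurable_centered t a b).mono (h.le_succ t) le_rfl).mul
        ((h.measurable t b).mono (ℱ.mono t.le_succ) le_rfl)

/-- The noise is orthogonal to every square-integrable function of the past. -/
lemma integral_mul_noise (h : IsLinearRecursion P ℱ 𝒢 M K γ s R D) (t : ℕ) (a : ι) {Z : Ω → ℝ}
    (hZ : Measurable[ℱ t] Z) (hZ2 : MemLp Z 2 P) : ∫ ω, Z ω * noise M s R D t ω a ∂P = 0 := by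
  have h1 : Integrable (fun ω => s t a ω * Z ω) P := (h.memLp_s t a).integrable_mul hZ2
  have h2 : ∀ b, Integrable (fun ω => (R t a b ω - M a b) * (Z ω * D t ω b)) P := fun b =>
    (indepFun_of_indep (h.indep t) (h.measurable_centered t a b)
      (hZ.mul (h.measurable t b))).integrable_mul
      ((h.memLp_centered t a b).integrable (by norm_num)) (hZ2.integrable_mul (h.memLp t b))
  have e : ∀ ω, Z ω * noise M s R D t ω a
      = s t a ω * Z ω + ∑ b, (R t a b ω - M a b) * (Z ω * D t ω b) := by
    intro ω
    rw [noise, mul_add, Finset.mul_sum]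
    congr 1
    · ring
    · exact Finset.sum_congr rfl fun b _ => by ring
  simp_rw [e]
  rw [integral_add h1 (integrable_finsetSum _ fun b _ => h2 b),
    integral_finsetSum _ fun b _ => h2 b,
    (indepFun_of_indep (h.indep t) (h.measurable_s t a) hZ).integral_fun_mul_eq_mul_integral
      (h.memLp_s t a).1 hZ2.1, h.integral_s, zero_mul, zero_add]
  refine Finset.sum_eq_zero fun b _ => ?_
  have h3 := (indepFun_of_indep (h.indep t) (h.measurable_centered t a b)
    (hZ.mul (h.measurable t b))).integral_fun_mul_eq_mul_integral
      (h.memLp_centered t a b).1 (hZ2.1.mul (h.memLp t b).1)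
  rw [h.integral_centered, zero_mul] at h3
  exact h3

lemma integral_noise_sq_le (h : IsLinearRecursion P ℱ 𝒢 M K γ s R D) (t : ℕ) (a : ι) :
    ∫ ω, noise M s R D t ω a ^ 2 ∂P
      ≤ 2 * (1 + Fintype.card ι) * K * (1 + ∑ b, ∫ ω, D t ω b ^ 2 ∂P) := by
  have hm : ∀ b, MemLp (fun ω => (R t a b ω - M a b) * D t ω b) 2 P := fun b =>
    memLp_mul_of_indep (h.indep t) (h.measurable_centered t a b) (h.measurable t b)
      (h.memLp_centered t a b) (h.memLp t b)
  have hK : 0 ≤ K := (integral_nonneg fun ω => sq_nonneg _).trans (h.sq_s_le t a)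
  have hpt : ∀ ω, noise M s R D t ω a ^ 2 ≤ 2 * s t a ω ^ 2
      + 2 * (Fintype.card ι * ∑ b, ((R t a b ω - M a b) * D t ω b) ^ 2) := by
    intro ω
    have h1 : (∑ b, (R t a b ω - M a b) * D t ω b) ^ 2
        ≤ Fintype.card ι * ∑ b, ((R t a b ω - M a b) * D t ω b) ^ 2 := sq_sum_le_card_mul_sum_sq
    have h2 := add_sq_le (a := s t a ω) (b := ∑ b, (R t a b ω - M a b) * D t ω b)
    rw [noise]
    linarith
  have hi1 : Integrable (fun ω => 2 * s t a ω ^ 2) P := (h.memLp_s t a).integrable_sq.const_mul _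
  have hi2 : Integrable (fun ω => 2 * (Fintype.card ι *
      ∑ b, ((R t a b ω - M a b) * D t ω b) ^ 2)) P :=
    ((integrable_finsetSum _ fun b _ => (hm b).integrable_sq).const_mul _).const_mul _
  have h1 := integral_mono (h.memLp_noise t a).integrable_sq (hi1.add hi2) hpt
  simp only [Pi.add_apply] at h1
  rw [integral_add hi1 hi2, integral_const_mul, integral_const_mul, integral_const_mul,
    integral_finsetSum _ fun b _ => (hm b).integrable_sq] at h1
  have h2 : ∑ b, ∫ ω, ((R t a b ω - M a b) * D t ω b) ^ 2 ∂P
      ≤ K * ∑ b, ∫ ω, D t ω b ^ 2 ∂P := by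
    rw [Finset.mul_sum]
    refine Finset.sum_le_sum fun b _ => ?_
    rw [integral_mul_sq_of_indep (h.indep t) (h.measurable_centered t a b) (h.measurable t b)
      (h.memLp_centered t a b) (h.memLp t b)]
    exact mul_le_mul_of_nonneg_right (h.sq_R_le t a b) (integral_nonneg fun ω => sq_nonneg _)
  have hS : 0 ≤ ∑ b, ∫ ω, D t ω b ^ 2 ∂P :=
    Finset.sum_nonneg fun b _ => integral_nonneg fun ω => sq_nonneg _
  have hc : (0 : ℝ) ≤ Fintype.card ι := Nat.cast_nonneg _
  nlinarith [mul_le_mul_of_nonneg_left h2 hc, h.sq_s_le t a, mul_nonneg hK hS, mul_nonneg hc hK]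

omit [IsProbabilityMeasure P] in
lemma step_eq (h : IsLinearRecursion P ℱ 𝒢 M K γ s R D) (t : ℕ) (ω : Ω) :
    D (t + 1) ω = (D t ω - γ t • (M *ᵥ D t ω)) - γ t • noise M s R D t ω := by
  funext a
  simp only [Pi.sub_apply, Pi.smul_apply, smul_eq_mul, h.step, noise, sub_mul,
    Finset.sum_sub_distrib, Matrix.mulVec, dotProduct]
  ring

lemma integrable_quadratic {κ : Type*} [Fintype κ] (h : IsLinearRecursion P ℱ 𝒢 M K γ s R D)
    (N : Matrix κ ι ℝ) (t : ℕ) : Integrable (fun ω => (N *ᵥ D t ω) ⬝ᵥ (N *ᵥ D t ω)) P :=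
  integrable_finsetSum _ fun k _ => (h.memLp_mulVec N t k).integrable_mul (h.memLp_mulVec N t k)

lemma integrable_dotProduct_self (h : IsLinearRecursion P ℱ 𝒢 M K γ s R D) (t : ℕ) :
    Integrable (fun ω => D t ω ⬝ᵥ D t ω) P :=
  integrable_finsetSum _ fun k _ => (h.memLp t k).integrable_mul (h.memLp t k)

/-- Bias–variance decomposition of one step: because the noise is centered given the past, it
enters `E ‖N D_{t+1}‖²` only at order `γ²`. -/
lemma exists_second_moment_step [DecidableEq ι] {κ : Type*} [Fintype κ]
    (h : IsLinearRecursion P ℱ 𝒢 M K γ s R D) (N : Matrix κ ι ℝ) :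
    ∃ C, 0 ≤ C ∧ ∀ t, ∫ ω, (N *ᵥ D (t + 1) ω) ⬝ᵥ (N *ᵥ D (t + 1) ω) ∂P
      ≤ (∫ ω, (N *ᵥ (D t ω - γ t • (M *ᵥ D t ω))) ⬝ᵥ (N *ᵥ (D t ω - γ t • (M *ᵥ D t ω))) ∂P)
        + γ t ^ 2 * C * (1 + ∫ ω, D t ω ⬝ᵥ D t ω ∂P) := by
  have hK : ∀ _ : ι, 0 ≤ K := fun a =>
    (integral_nonneg fun ω => sq_nonneg _).trans (h.sq_s_le 0 a)
  refine ⟨∑ k, (N k ⬝ᵥ N k) * ∑ _a : ι, 2 * (1 + Fintype.card ι) * K,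
    Finset.sum_nonneg fun k _ => mul_nonneg (real_dotProduct_self_nonneg _)
      (Finset.sum_nonneg fun a _ => by have := hK a; positivity), fun t => ?_⟩
  set S := 1 + ∫ ω, D t ω ⬝ᵥ D t ω ∂P with hS
  have hS' : S = 1 + ∑ b, ∫ ω, D t ω b ^ 2 ∂P := by
    rw [hS]
    simp only [dotProduct, ← sq]
    rw [integral_finsetSum _ fun b _ => (h.memLp t b).integrable_sq]
  have hA : ∀ ω, N *ᵥ (D t ω - γ t • (M *ᵥ D t ω)) = (N * (1 - γ t • M)) *ᵥ D t ω := by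
    intro ω
    rw [← Matrix.mulVec_mulVec, Matrix.sub_mulVec, Matrix.one_mulVec, Matrix.smul_mulVec]
  have hX := fun k => h.memLp_mulVec (N * (1 - γ t • M)) t k
  have hW : ∀ k, MemLp (fun ω => (N *ᵥ noise M s R D t ω) k) 2 P := fun k =>
    memLp_finsetSum _ fun a _ => (h.memLp_noise t a).const_mul (N k a)
  have horth : ∀ k, ∫ ω, ((N * (1 - γ t • M)) *ᵥ D t ω) k * (N *ᵥ noise M s R D t ω) k ∂P = 0 := by
    intro k
    have e : ∀ ω, ((N * (1 - γ t • M)) *ᵥ D t ω) k * (N *ᵥ noise M s R D t ω) k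
        = ∑ a, N k a * (((N * (1 - γ t • M)) *ᵥ D t ω) k * noise M s R D t ω a) := by
      intro ω
      rw [Matrix.mulVec, Matrix.mulVec, dotProduct, dotProduct, Finset.mul_sum]
      exact Finset.sum_congr rfl fun a _ => by ring
    simp_rw [e]
    rw [integral_finsetSum _ fun a _ => (integrable_fun_mul (hX k) (h.memLp_noise t a)).const_mul _]
    refine Finset.sum_eq_zero fun a _ => ?_
    rw [integral_const_mul, h.integral_mul_noise t a (h.measurable_mulVec _ t k) (hX k), mul_zero]
  have hvar : ∀ k, ∫ ω, (N *ᵥ noise M s R D t ω) k ^ 2 ∂P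
      ≤ (N k ⬝ᵥ N k) * ((∑ _a : ι, 2 * (1 + Fintype.card ι) * K) * S) := by
    intro k
    have hpt : ∀ ω, (N *ᵥ noise M s R D t ω) k ^ 2
        ≤ (N k ⬝ᵥ N k) * ∑ a, noise M s R D t ω a ^ 2 := by
      intro ω
      have := sq_dotProduct_le (N k) (noise M s R D t ω)
      simpa [dotProduct, sq, Matrix.mulVec] using this
    have hi : Integrable (fun ω => ∑ a, noise M s R D t ω a ^ 2) P :=
      integrable_finsetSum _ fun a _ => (h.memLp_noise t a).integrable_sq
    refine (integral_mono (hW k).integrable_sq (hi.const_mul _) hpt).trans ?_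
    rw [integral_const_mul, integral_finsetSum _ fun a _ => (h.memLp_noise t a).integrable_sq,
      Finset.sum_mul]
    refine mul_le_mul_of_nonneg_left (Finset.sum_le_sum fun a _ => ?_)
      (real_dotProduct_self_nonneg _)
    rw [hS']
    exact h.integral_noise_sq_le t a
  have hsum : ∫ ω, (N *ᵥ D (t + 1) ω) ⬝ᵥ (N *ᵥ D (t + 1) ω) ∂P
      = (∫ ω, (N *ᵥ (D t ω - γ t • (M *ᵥ D t ω))) ⬝ᵥ (N *ᵥ (D t ω - γ t • (M *ᵥ D t ω))) ∂P)
        + γ t ^ 2 * ∑ k, ∫ ω, (N *ᵥ noise M s R D t ω) k ^ 2 ∂P := by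
    simp_rw [h.step_eq, Matrix.mulVec_sub N (_ - _), Matrix.mulVec_smul N, hA]
    simp only [dotProduct]
    rw [integral_finsetSum _ fun k _ => integrable_fun_mul (hX k) (hX k),
      integral_finsetSum, Finset.mul_sum, ← Finset.sum_add_distrib]
    · refine Finset.sum_congr rfl fun k _ => ?_
      have e : ∀ ω, ((N * (1 - γ t • M)) *ᵥ D t ω - γ t • N *ᵥ noise M s R D t ω : κ → ℝ) k *
          ((N * (1 - γ t • M)) *ᵥ D t ω - γ t • N *ᵥ noise M s R D t ω : κ → ℝ) k
          = (((N * (1 - γ t • M)) *ᵥ D t ω) k * ((N * (1 - γ t • M)) *ᵥ D t ω) k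
            - 2 * γ t * (((N * (1 - γ t • M)) *ᵥ D t ω) k * (N *ᵥ noise M s R D t ω) k))
            + γ t ^ 2 * (N *ᵥ noise M s R D t ω) k ^ 2 := by
        intro ω
        simp only [Pi.sub_apply, Pi.smul_apply, smul_eq_mul]
        ring
      simp_rw [e]
      rw [integral_add, integral_sub, integral_const_mul, horth, integral_const_mul, mul_zero,
        sub_zero]
      · exact (hX k).integrable_mul (hX k)
      · exact ((hX k).integrable_mul (hW k)).const_mul _
      · exact ((hX k).integrable_mul (hX k)).sub (((hX k).integrable_mul (hW k)).const_mul _)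
      · exact (hW k).integrable_sq.const_mul _
    · intro k _
      have := (hX k).sub ((hW k).const_mul (γ t))
      exact this.integrable_mul this
  rw [hsum, mul_assoc, Finset.sum_mul]
  gcongr with k
  rw [mul_assoc]
  exact hvar k

end IsLinearRecursion

/-! ### Convergence of linear recursions -/

lemma ae_summable_of_summable_integral_norm {Ω : Type*} {mΩ : MeasurableSpace Ω} {P : Measure Ω}
    {F : ℕ → Ω → ℝ} (hF : ∀ k, Integrable (F k) P) (hs : Summable fun k => ∫ ω, ‖F k ω‖ ∂P) :
    ∀ᵐ ω ∂P, Summable fun k => F k ω := by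
  have h1 : ∫⁻ ω, ∑' k, ‖F k ω‖ₑ ∂P ≠ ⊤ := by
    rw [lintegral_tsum fun k => (hF k).1.enorm]
    simp_rw [← ofReal_integral_norm_eq_lintegral_enorm (hF _)]
    exact hs.tsum_ofReal_ne_top
  have h2 := ae_lt_top' (AEMeasurable.tsum fun k => (hF k).1.enorm) h1
  filter_upwards [h2] with ω hω
  have h3 : Summable fun k => ‖F k ω‖₊ := ENNReal.tsum_coe_ne_top_iff_summable.1 hω.ne
  exact Summable.of_norm (NNReal.summable_coe.2 h3)

lemma summable_one_div_succ_mul_sqrt :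
    Summable fun k : ℕ => 1 / (((k : ℝ) + 1) * √((k : ℝ) + 1)) := by
  have h := (summable_nat_add_iff 1).2
    (Real.summable_one_div_nat_rpow.2 (by norm_num : (1 : ℝ) < 3 / 2))
  refine h.congr fun k => ?_
  have hk : (0 : ℝ) < (k : ℝ) + 1 := by positivity
  rw [Real.sqrt_eq_rpow, ← Real.rpow_one_add' hk.le (by norm_num)]
  norm_num

namespace IsLinearRecursion

variable {ι κ Ω : Type*} [Fintype ι] [Fintype κ] {mΩ : MeasurableSpace Ω} {P : Measure Ω}
  [IsProbabilityMeasure P] {ℱ : Filtration ℕ mΩ} {𝒢 : ℕ → MeasurableSpace Ω}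
  {G : Matrix κ ι ℝ} {K g ρ : ℝ} {s : ℕ → ι → Ω → ℝ} {R : ℕ → ι → ι → Ω → ℝ}
  {D : ℕ → Ω → ι → ℝ}

/-- The noise is not controlled by `‖G D‖²` alone, but square-summable steps keep the second
moments bounded. -/
lemma exists_second_moment_le [DecidableEq ι]
    (h : IsLinearRecursion P ℱ 𝒢 (2 • (Gᵀ * G)) K (fun t => g / ((t : ℝ) + 1)) s R D)
    (hg : 0 < g) : ∃ B, ∀ t, ∫ ω, D t ω ⬝ᵥ D t ω ∂P ≤ B := by
  obtain ⟨C₁, hC₁, h1⟩ := h.exists_second_moment_step (1 : Matrix ι ι ℝ)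
  obtain ⟨C₂, hC₂, h2⟩ := exists_gradient_step_sq_le G
  simp only [Matrix.one_mulVec] at h1
  refine bounded_of_recursion (C := g ^ 2 * (C₁ + C₂)) (by positivity)
    (fun t => integral_nonneg fun ω => real_dotProduct_self_nonneg _) fun t => (h1 t).trans ?_
  have hγ : 0 ≤ g / ((t : ℝ) + 1) := by positivity
  have hi := h.integrable_dotProduct_self t
  have h3 := integral_mono_of_nonneg
    (Eventually.of_forall fun ω => real_dotProduct_self_nonneg _)
    (hi.const_mul (1 + (g / ((t : ℝ) + 1)) ^ 2 * C₂)) (μ := P)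
    (Eventually.of_forall fun ω => h2 _ hγ (D t ω))
  rw [integral_const_mul] at h3
  have h0 : 0 ≤ ∫ ω, D t ω ⬝ᵥ D t ω ∂P := integral_nonneg fun ω => real_dotProduct_self_nonneg _
  have hE : g ^ 2 * (C₁ + C₂) / ((t : ℝ) + 1) ^ 2 = (g / ((t : ℝ) + 1)) ^ 2 * (C₁ + C₂) := by
    rw [div_pow]; ring
  rw [hE]
  nlinarith [mul_nonneg (sq_nonneg (g / ((t : ℝ) + 1))) hC₂]

/-- The expected gap decays like `1 / t` if the step-size factor `g` beats the contraction rate. -/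
lemma exists_gap_le [DecidableEq ι]
    (h : IsLinearRecursion P ℱ 𝒢 (2 • (Gᵀ * G)) K (fun t => g / ((t : ℝ) + 1)) s R D)
    (hg : 0 < g)
    (hρ : ∀ v, ρ * ((G *ᵥ v) ⬝ᵥ (G *ᵥ v)) ≤ (Gᵀ *ᵥ (G *ᵥ v)) ⬝ᵥ (Gᵀ *ᵥ (G *ᵥ v)))
    (hρg : 1 < 4 * ρ * g) :
    ∃ B, 0 ≤ B ∧ ∀ t : ℕ, ∫ ω, (G *ᵥ D t ω) ⬝ᵥ (G *ᵥ D t ω) ∂P ≤ B / ((t : ℝ) + 1) := by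
  obtain ⟨B, hB⟩ := h.exists_second_moment_le hg
  have hB0 : 0 ≤ B := (integral_nonneg fun ω => real_dotProduct_self_nonneg _).trans (hB 0)
  obtain ⟨C₁, hC₁, h1⟩ := h.exists_second_moment_step G
  obtain ⟨C₂, hC₂, h2⟩ := exists_gradient_step_gap_le G hρ
  refine rate_of_recursion (C := g ^ 2 * (C₁ * (1 + B) + C₂ * B)) hρg (by positivity)
    (fun t => integral_nonneg fun ω => real_dotProduct_self_nonneg _) fun t => (h1 t).trans ?_
  have hγ : 0 ≤ g / ((t : ℝ) + 1) := by positivity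
  have h3 := integral_mono_of_nonneg
    (Eventually.of_forall fun ω => real_dotProduct_self_nonneg _)
    (((h.integrable_quadratic G t).const_mul (1 - 4 * ρ * (g / ((t : ℝ) + 1)))).add
      ((h.integrable_dotProduct_self t).const_mul ((g / ((t : ℝ) + 1)) ^ 2 * C₂))) (μ := P)
    (Eventually.of_forall fun ω => h2 _ hγ (D t ω))
  simp only [Pi.add_apply] at h3
  rw [integral_add ((h.integrable_quadratic G t).const_mul _)
    ((h.integrable_dotProduct_self t).const_mul _), integral_const_mul, integral_const_mul] at h3
  have hE : g ^ 2 * (C₁ * (1 + B) + C₂ * B) / ((t : ℝ) + 1) ^ 2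
      = (g / ((t : ℝ) + 1)) ^ 2 * (C₁ * (1 + B) + C₂ * B) := by
    rw [div_pow]; ring
  have hE' : 4 * ρ * g / ((t : ℝ) + 1) = 4 * ρ * (g / ((t : ℝ) + 1)) := by ring
  rw [hE, hE']
  have h4 := mul_le_mul_of_nonneg_left (hB t) (mul_nonneg (sq_nonneg (g / ((t : ℝ) + 1))) hC₁)
  have h5 := mul_le_mul_of_nonneg_left (hB t) (mul_nonneg (sq_nonneg (g / ((t : ℝ) + 1))) hC₂)
  nlinarith

/-- The accumulated drift `∑ γ_k M D_k` converges absolutely in mean: since `M D = 2 Gᵀ (G D)` and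
`E ‖G D_k‖² = O(1/k)`, its terms are of order `k^(-3/2)`. -/
lemma summable_integral_drift [DecidableEq ι]
    (h : IsLinearRecursion P ℱ 𝒢 (2 • (Gᵀ * G)) K (fun t => g / ((t : ℝ) + 1)) s R D)
    (hg : 0 < g)
    (hρ : ∀ v, ρ * ((G *ᵥ v) ⬝ᵥ (G *ᵥ v)) ≤ (Gᵀ *ᵥ (G *ᵥ v)) ⬝ᵥ (Gᵀ *ᵥ (G *ᵥ v)))
    (hρg : 1 < 4 * ρ * g) (a : ι) :
    Summable fun k : ℕ => ∫ ω, ‖g / ((k : ℝ) + 1) * ((2 • (Gᵀ * G)) *ᵥ D k ω) a‖ ∂P := by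
  obtain ⟨B, hB0, hB⟩ := h.exists_gap_le hg hρ hρg
  obtain ⟨C, hC0, hC⟩ := exists_mulVec_sq_le (2 • Gᵀ)
  have hsq : ∀ v : ι → ℝ, ((2 • (Gᵀ * G)) *ᵥ v) a ^ 2 ≤ C * ((G *ᵥ v) ⬝ᵥ (G *ᵥ v)) := by
    intro v
    have e : (2 • (Gᵀ * G)) *ᵥ v = (2 • Gᵀ) *ᵥ (G *ᵥ v) := by
      rw [Matrix.mulVec_mulVec, Matrix.smul_mul]
    refine le_trans ?_ (hC (G *ᵥ v))
    rw [e, sq]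
    exact Finset.single_le_sum (f := fun a => ((2 • Gᵀ) *ᵥ (G *ᵥ v)) a * ((2 • Gᵀ) *ᵥ (G *ᵥ v)) a)
      (fun _ _ => mul_self_nonneg _) (Finset.mem_univ a)
  refine Summable.of_nonneg_of_le (fun k => integral_nonneg fun ω => norm_nonneg _) (fun k => ?_)
    (summable_one_div_succ_mul_sqrt.mul_left (g * (C * B + 1)))
  have hk : (0 : ℝ) < (k : ℝ) + 1 := by positivity
  set q := √((k : ℝ) + 1) with hq
  have hq0 : 0 < q := Real.sqrt_pos.2 hk
  have hqq : q * q = (k : ℝ) + 1 := Real.mul_self_sqrt hk.le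
  -- Young's inequality with the weight `√(k + 1)` balances the two terms.
  have hpt : ∀ ω, ‖g / ((k : ℝ) + 1) * ((2 • (Gᵀ * G)) *ᵥ D k ω) a‖
      ≤ g / ((k : ℝ) + 1) * (q * C * ((G *ᵥ D k ω) ⬝ᵥ (G *ᵥ D k ω)) + 1 / q) := by
    intro ω
    rw [norm_mul, Real.norm_of_nonneg (by positivity : 0 ≤ g / ((k : ℝ) + 1))]
    refine mul_le_mul_of_nonneg_left ?_ (by positivity)
    set y := ((2 • (Gᵀ * G)) *ᵥ D k ω) a with hy
    have h1 : |y| ≤ q * y ^ 2 + 1 / q := by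
      have h2 : 0 ≤ (q * |y| - 1) ^ 2 / q := by positivity
      have h3 : (q * |y| - 1) ^ 2 / q = q * y ^ 2 - 2 * |y| + 1 / q := by
        field_simp
        rw [← sq_abs y]; ring
      linarith [abs_nonneg y]
    have h2 := mul_le_mul_of_nonneg_left (hsq (D k ω)) hq0.le
    rw [Real.norm_eq_abs]
    linarith
  have hi : Integrable (fun ω => q * C * ((G *ᵥ D k ω) ⬝ᵥ (G *ᵥ D k ω)) + 1 / q) P :=
    ((h.integrable_quadratic G k).const_mul _).add (integrable_const _)
  refine (integral_mono_of_nonneg (Eventually.of_forall fun ω => norm_nonneg _)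
    (hi.const_mul _) (Eventually.of_forall hpt)).trans ?_
  rw [integral_const_mul, integral_add ((h.integrable_quadratic G k).const_mul _)
    (integrable_const _), integral_const_mul]
  simp only [integral_const, probReal_univ, one_smul]
  have h1 : q * C * ∫ ω, (G *ᵥ D k ω) ⬝ᵥ (G *ᵥ D k ω) ∂P ≤ C * B / q := by
    have h2 := mul_le_mul_of_nonneg_left (hB k) (by positivity : 0 ≤ q * C)
    refine h2.trans (le_of_eq ?_)
    rw [← hqq]; field_simp
  calc g / ((k : ℝ) + 1) * (q * C * ∫ ω, (G *ᵥ D k ω) ⬝ᵥ (G *ᵥ D k ω) ∂P + 1 / q)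
      ≤ g / ((k : ℝ) + 1) * (C * B / q + 1 / q) := by gcongr
    _ = _ := by field_simp

omit [IsProbabilityMeasure P] [Fintype κ] in
lemma eq_sub_sums {M : Matrix ι ι ℝ} {γ : ℕ → ℝ} (h : IsLinearRecursion P ℱ 𝒢 M K γ s R D)
    (t : ℕ) (ω : Ω) (a : ι) :
    D t ω a = D 0 ω a - ∑ k ∈ Finset.range t, γ k * (M *ᵥ D k ω) a
      - ∑ k ∈ Finset.range t, γ k * noise M s R D k ω a := by
  induction t with
  | zero => simp
  | succ t ih =>
    rw [Finset.sum_range_succ, Finset.sum_range_succ, h.step_eq]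
    simp only [Pi.sub_apply, Pi.smul_apply, smul_eq_mul]
    rw [ih]; ring

omit [Fintype κ] in
lemma martingale_sum_noise {M : Matrix ι ι ℝ} {γ : ℕ → ℝ}
    (h : IsLinearRecursion P ℱ 𝒢 M K γ s R D) (a : ι) :
    Martingale (fun t ω => ∑ k ∈ Finset.range t, γ k * noise M s R D k ω a) ℱ P := by
  have hi : ∀ k, Integrable (fun ω => γ k * noise M s R D k ω a) P := fun k =>
    ((h.memLp_noise k a).integrable (by norm_num)).const_mul _
  refine martingale_of_setIntegral_eq_succ (fun t => ?_)
    (fun t => integrable_finsetSum _ fun k _ => hi k) fun t A hA => ?_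
  · refine Measurable.stronglyMeasurable (Finset.measurable_fun_sum _ fun k hk => ?_)
    exact Measurable.const_mul ((h.measurable_noise k a).mono
      (ℱ.mono (Finset.mem_range.1 hk)) le_rfl) _
  · simp_rw [Finset.sum_range_succ]
    rw [integral_add (integrable_finsetSum _ fun k _ => hi k).integrableOn (hi t).integrableOn,
      integral_const_mul]
    have h1 : Measurable[ℱ t] (A.indicator fun _ => (1 : ℝ)) := measurable_const.indicator hA
    have h2 : MemLp (A.indicator fun _ => (1 : ℝ)) 2 P :=
      (memLp_const 1).indicator (ℱ.le t A hA)
    have h3 := h.integral_mul_noise t a h1 h2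
    have h4 : ∀ ω, A.indicator (fun _ => (1 : ℝ)) ω * noise M s R D t ω a
        = A.indicator (fun ω => noise M s R D t ω a) ω := by
      intro ω; by_cases hω : ω ∈ A <;> simp [hω]
    simp_rw [h4] at h3
    rw [integral_indicator (ℱ.le t A hA)] at h3
    rw [h3, mul_zero, add_zero]

/-- Almost sure convergence of the recursion to a zero of `G`. The drift is absolutely summable,
and the accumulated noise is a martingale that is bounded in `L¹` because it is the difference of
bounded terms, so it converges too. -/
lemma ae_exists_tendsto [DecidableEq ι]
    (h : IsLinearRecursion P ℱ 𝒢 (2 • (Gᵀ * G)) K (fun t => g / ((t : ℝ) + 1)) s R D)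
    (hg : 0 < g)
    (hρ : ∀ v, ρ * ((G *ᵥ v) ⬝ᵥ (G *ᵥ v)) ≤ (Gᵀ *ᵥ (G *ᵥ v)) ⬝ᵥ (Gᵀ *ᵥ (G *ᵥ v)))
    (hρg : 1 < 4 * ρ * g) :
    ∀ᵐ ω ∂P, ∃ v, Tendsto (fun t => D t ω) atTop (𝓝 v) ∧ G *ᵥ v = 0 := by
  set M : Matrix ι ι ℝ := 2 • (Gᵀ * G) with hM
  set γ : ℕ → ℝ := fun t => g / ((t : ℝ) + 1) with hγ
  have hdi : ∀ a k, Integrable (fun ω => γ k * (M *ᵥ D k ω) a) P := fun a k =>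
    ((h.memLp_mulVec M k a).integrable (by norm_num)).const_mul _
  have hdrift := fun a => h.summable_integral_drift hg hρ hρg a
  obtain ⟨B, hB⟩ := h.exists_second_moment_le hg
  have hconv : ∀ a, ∀ᵐ ω ∂P, ∃ y, Tendsto (fun t => D t ω a) atTop (𝓝 y) := by
    intro a
    have h1 := ae_summable_of_summable_integral_norm (hdi a) (hdrift a)
    have hDi : ∀ t, Integrable (fun ω => D t ω a) P := fun t =>
      (h.memLp t a).integrable (by norm_num)
    have hDB : ∀ t, ∫ ω, ‖D t ω a‖ ∂P ≤ B + 1 := by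
      intro t
      have hi := (h.integrable_dotProduct_self t).add (integrable_const (1 : ℝ))
      refine (integral_mono (hDi t).norm hi fun ω => ?_).trans
        (?_ : _ ≤ B + 1)
      · have h2 : D t ω a * D t ω a ≤ D t ω ⬝ᵥ D t ω :=
          Finset.single_le_sum (f := fun a => D t ω a * D t ω a)
            (fun _ _ => mul_self_nonneg _) (Finset.mem_univ a)
        simp only [Pi.add_apply, Real.norm_eq_abs]
        nlinarith [sq_nonneg (|D t ω a| - 1), abs_mul_abs_self (D t ω a), abs_nonneg (D t ω a)]
      · simp only [Pi.add_apply]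
        rw [integral_add (h.integrable_dotProduct_self t) (integrable_const _)]
        simpa using hB t
    have hbdd : ∀ t, eLpNorm (fun ω => ∑ k ∈ Finset.range t, γ k * noise M s R D k ω a) 1 P
        ≤ ((B + 1 + (B + 1) + ∑' k, ∫ ω, ‖γ k * (M *ᵥ D k ω) a‖ ∂P).toNNReal : NNReal) := by
      intro t
      have hNi : Integrable (fun ω => ∑ k ∈ Finset.range t, γ k * noise M s R D k ω a) P :=
        (h.martingale_sum_noise a).integrable t
      rw [eLpNorm_one_eq_lintegral_enorm, ← ofReal_integral_norm_eq_lintegral_enorm hNi]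
      refine ENNReal.ofReal_le_ofReal ?_
      have hsi : Integrable (fun ω => ∑ k ∈ Finset.range t, ‖γ k * (M *ᵥ D k ω) a‖) P :=
        integrable_finsetSum _ fun k _ => (hdi a k).norm
      have hle : ∀ ω, ‖∑ k ∈ Finset.range t, γ k * noise M s R D k ω a‖
          ≤ ‖D 0 ω a‖ + ‖D t ω a‖ + ∑ k ∈ Finset.range t, ‖γ k * (M *ᵥ D k ω) a‖ := by
        intro ω
        have e : ∑ k ∈ Finset.range t, γ k * noise M s R D k ω a
            = D 0 ω a - D t ω a - ∑ k ∈ Finset.range t, γ k * (M *ᵥ D k ω) a := by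
          have := h.eq_sub_sums t ω a
          linarith
        rw [e]
        refine (norm_sub_le _ _).trans (add_le_add (norm_sub_le _ _) (norm_sum_le _ _))
      refine (integral_mono hNi.norm (((hDi 0).norm.add (hDi t).norm).add hsi) hle).trans ?_
      have h0t : Integrable (fun ω => ‖D 0 ω a‖ + ‖D t ω a‖) P := (hDi 0).norm.add (hDi t).norm
      simp only [Pi.add_apply]
      rw [integral_add h0t hsi, integral_add (hDi 0).norm (hDi t).norm,
        integral_finsetSum _ fun k _ => (hdi a k).norm]
      exact add_le_add (add_le_add (hDB 0) (hDB t)) ((hdrift a).sum_le_tsum _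
        fun k _ => integral_nonneg fun ω => norm_nonneg _)
    have h2 := (h.martingale_sum_noise a).submartingale.exists_ae_tendsto_of_bdd hbdd
    filter_upwards [h1, h2] with ω hω1 ⟨c, hc⟩
    obtain ⟨v, hv⟩ := h.init
    refine ⟨v a - ∑' k, γ k * (M *ᵥ D k ω) a - c, ?_⟩
    refine ((tendsto_const_nhds.sub hω1.hasSum.tendsto_sum_nat).sub hc).congr fun t => ?_
    rw [h.eq_sub_sums t ω a, hv]
  obtain ⟨B', hB0', hB'⟩ := h.exists_gap_le hg hρ hρg
  -- Fatou's lemma: the lower limit of `‖G D_t‖²` has expectation zero.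
  have hfatou : ∀ᵐ ω ∂P,
      liminf (fun t => ENNReal.ofReal ((G *ᵥ D t ω) ⬝ᵥ (G *ᵥ D t ω))) atTop = 0 := by
    have hmeas : ∀ t, Measurable
        (fun ω => ENNReal.ofReal ((G *ᵥ D t ω) ⬝ᵥ (G *ᵥ D t ω))) := fun t => by
      have hm : ∀ k, Measurable fun ω => (G *ᵥ D t ω) k := fun k =>
        (h.measurable_mulVec G t k).mono (ℱ.le t) le_rfl
      exact (Finset.measurable_fun_sum _ fun k _ => (hm k).mul (hm k)).ennreal_ofReal
    have h1 := lintegral_liminf_le (μ := P) (u := atTop) hmeas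
    have h2 : Tendsto (fun t => ∫⁻ ω, ENNReal.ofReal ((G *ᵥ D t ω) ⬝ᵥ (G *ᵥ D t ω)) ∂P)
        atTop (𝓝 0) := by
      simp_rw [← ofReal_integral_eq_lintegral_ofReal (h.integrable_quadratic G _)
        (Eventually.of_forall fun ω => real_dotProduct_self_nonneg _)]
      rw [← ENNReal.ofReal_zero]
      refine (ENNReal.continuous_ofReal.tendsto 0).comp ?_
      refine squeeze_zero (fun t => integral_nonneg fun ω => real_dotProduct_self_nonneg _) hB' ?_
      exact tendsto_const_nhds.div_atTop
        (tendsto_atTop_add_const_right _ _ tendsto_natCast_atTop_atTop)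
    rw [h2.liminf_eq] at h1
    exact (lintegral_eq_zero_iff (Measurable.liminf hmeas)).1 (le_antisymm h1 zero_le)
  filter_upwards [ae_all_iff.2 hconv, hfatou] with ω hω1 hω2
  choose v hv using hω1
  have hv' : Tendsto (fun t => D t ω) atTop (𝓝 v) := tendsto_pi_nhds.2 hv
  refine ⟨v, hv', ?_⟩
  have hc : Continuous fun v : ι → ℝ => ENNReal.ofReal ((G *ᵥ v) ⬝ᵥ (G *ᵥ v)) :=
    ENNReal.continuous_ofReal.comp (by fun_prop)
  have h1 := ((hc.tendsto v).comp hv').liminf_eq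
  have h2 : ENNReal.ofReal ((G *ᵥ v) ⬝ᵥ (G *ᵥ v)) = 0 := h1.symm.trans hω2
  exact dotProduct_self_eq_zero.1
    (le_antisymm (ENNReal.ofReal_eq_zero.1 h2) (real_dotProduct_self_nonneg _))

end IsLinearRecursion

/-! ### Singular values and the Polyak–Łojasiewicz inequality -/

lemma norm_toLp_sq {ι : Type*} [Fintype ι] (v : ι → ℝ) :
    ‖(WithLp.toLp 2 v : EuclideanSpace ℝ ι)‖ ^ 2 = v ⬝ᵥ v := by
  rw [EuclideanSpace.real_norm_sq_eq]
  simp [dotProduct, sq]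

/-- In an eigenbasis of `Tᵀ T` with eigenvalues `σ_i²`, the two sides are `∑ σ_i² c_i²` and
`∑ σ_i⁴ c_i²`. -/
lemma mul_norm_sq_le_of_singularValues {E : Type*} [NormedAddCommGroup E] [InnerProductSpace ℝ E]
    [FiniteDimensional ℝ E] (T : E →ₗ[ℝ] E) {ρ : ℝ}
    (hρ : ∀ i, 0 < T.singularValues i → ρ ≤ T.singularValues i ^ 2) (v : E) :
    ρ * ‖T v‖ ^ 2 ≤ ‖T.adjoint (T v)‖ ^ 2 := by
  have hS := T.isSymmetric_adjoint_comp_self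
  set b := hS.eigenvectorBasis rfl with hb
  have hσ := fun i => T.sq_singularValues_fin rfl i
  have hcoord : ∀ i, ⟪b i, T.adjoint (T v)⟫ = T.singularValues i ^ 2 * ⟪b i, v⟫ := by
    intro i
    have h1 := hS (b i) v
    rw [hS.apply_eigenvectorBasis rfl i, ← hσ, LinearMap.comp_apply] at h1
    rw [← h1, real_inner_smul_left]
    rfl
  have h1 : ‖T.adjoint (T v)‖ ^ 2 = ∑ i : Fin (Module.finrank ℝ E),
      (T.singularValues i ^ 2) ^ 2 * ⟪b i, v⟫ ^ 2 := by
    rw [← b.sum_sq_norm_inner_right]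
    refine Finset.sum_congr rfl fun i _ => ?_
    rw [hcoord, Real.norm_eq_abs, sq_abs, mul_pow]
  have h2 : ‖T v‖ ^ 2 = ∑ i : Fin (Module.finrank ℝ E), T.singularValues i ^ 2 * ⟪b i, v⟫ ^ 2 := by
    rw [← real_inner_self_eq_norm_sq, ← LinearMap.adjoint_inner_right, ← b.sum_inner_mul_inner]
    refine Finset.sum_congr rfl fun i _ => ?_
    rw [hcoord, real_inner_comm]
    ring
  rw [h1, h2, Finset.mul_sum]
  refine Finset.sum_le_sum fun i _ => ?_
  rw [← mul_assoc]
  refine mul_le_mul_of_nonneg_right ?_ (sq_nonneg _)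
  rcases (T.singularValues_nonneg i).eq_or_lt with h0 | h0
  · simp [← h0]
  · rw [sq (T.singularValues i ^ 2)]
    exact mul_le_mul_of_nonneg_right (hρ i h0) (sq_nonneg _)

namespace QuadGame

variable {n d : ℕ} {m : Fin n → ℕ} (Γ : QuadGame n d m)

/-- The step-size condition `g > 1 / μ_F` provides a constant `ρ` in the Polyak–Łojasiewicz
inequality of `‖G v‖²` that is large enough for the rate `1 / t`. -/
lemma exists_pl_constant {g : ℝ} (hg : 1 / Γ.muF < g) :
    ∃ ρ : ℝ, 1 < 4 * ρ * g ∧ ∀ v, ρ * ((Γ.G *ᵥ v) ⬝ᵥ (Γ.G *ᵥ v))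
      ≤ (Γ.Gᵀ *ᵥ (Γ.G *ᵥ v)) ⬝ᵥ (Γ.Gᵀ *ᵥ (Γ.G *ᵥ v)) := by
  set T := Matrix.toEuclideanLin Γ.G with hT
  set S : Set ℝ := {s | 0 < s ∧ s ∈ Set.range T.singularValues} with hS
  have hbdd : BddBelow S := ⟨0, fun s hs => hs.1.le⟩
  have hconv : ∀ ρ : ℝ, (∀ i, 0 < T.singularValues i → ρ ≤ T.singularValues i ^ 2) →
      ∀ v, ρ * ((Γ.G *ᵥ v) ⬝ᵥ (Γ.G *ᵥ v))
      ≤ (Γ.Gᵀ *ᵥ (Γ.G *ᵥ v)) ⬝ᵥ (Γ.Gᵀ *ᵥ (Γ.G *ᵥ v)) := by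
    intro ρ hρ v
    have h := mul_norm_sq_le_of_singularValues T hρ (WithLp.toLp 2 v)
    rw [hT, ← Matrix.toEuclideanLin_conjTranspose_eq_adjoint, Matrix.toLpLin_toLp,
      Matrix.toLpLin_toLp, norm_toLp_sq, norm_toLp_sq] at h
    simpa using h
  rcases S.eq_empty_or_nonempty with hE | hE
  · -- No positive singular value: then `G = 0` and every `ρ` works.
    have h0 : Γ.muF = 0 := by
      have : Γ.sigmaMinPos = sInf S := rfl
      simp [muF, this, hE]
    rw [h0] at hg
    have hg0 : 0 < g := by simpa using hg
    refine ⟨1 / g, ?_, hconv _ fun i hi => ?_⟩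
    · field_simp; norm_num
    · have : T.singularValues i ∈ S := ⟨hi, i, rfl⟩
      rw [hE] at this
      exact this.elim
  · have hfin : S.Finite := (Finsupp.finite_range _).subset fun s hs => hs.2
    have hpos : 0 < Γ.sigmaMinPos := (hE.csInf_mem hfin).1
    refine ⟨Γ.sigmaMinPos ^ 2, ?_, hconv _ fun i hi => ?_⟩
    · rw [muF, div_lt_iff₀ (by positivity)] at hg
      linarith
    · exact pow_le_pow_left₀ hpos.le (csInf_le hbdd ⟨hi, i, rfl⟩) 2

/-! ### The gap function and generalized Nash equilibria -/

/-- The joint vector `z = [x, λ]`. -/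
def joint (x : Action n d) (l : DualVars m) : (Fin n × Fin d) ⊕ (Σ i, Fin (m i)) → ℝ :=
  Sum.elim (flat x) fun s => l s.1 s.2

/-- The vector `e = [r_1^1, …, r_n^n, -b_1, …, -b_n]`. -/
def offset : (Fin n × Fin d) ⊕ (Σ i, Fin (m i)) → ℝ :=
  Sum.elim (fun p => Γ.r p.1 p) fun s => -Γ.b s.1 s.2

/-- The gradient of the Lagrangian `L_i` in the own action of player `i`. -/
noncomputable def ownGrad (i : Fin n) (x : Action n d) (l : EuclideanSpace ℝ (Fin (m i))) :
    Fin d → ℝ :=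
  Γ.H i *ᵥ flat x + (fun a => Γ.r i (i, a)) + Γ.Aown i *ᵥ l.ofLp

lemma G_mulVec_inl (x : Action n d) (l : DualVars m) (i : Fin n) (a : Fin d) :
    (Γ.G *ᵥ joint x l + Γ.offset) (.inl (i, a)) = Γ.ownGrad i x (l i) a := by
  have h1 : (Γ.G *ᵥ joint x l) (.inl (i, a))
      = (Γ.H i *ᵥ flat x) a + (Γ.Aown i *ᵥ (l i).ofLp) a := by
    simp only [Matrix.mulVec, dotProduct, Fintype.sum_sum_type, G, joint, Matrix.fromBlocks_apply₁₁,
      Matrix.fromBlocks_apply₁₂, Matrix.of_apply, Sum.elim_inl, Sum.elim_inr]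
    congr 1
    rw [Fintype.sum_sigma, Finset.sum_eq_single i]
    · simp
    · intro j _ hj; simp [hj]
    · simp
  rw [Pi.add_apply, h1]
  simp only [ownGrad, Pi.add_apply, offset, Sum.elim_inl]
  ring

lemma G_mulVec_inr (x : Action n d) (l : DualVars m) (i : Fin n) (k : Fin (m i)) :
    (Γ.G *ᵥ joint x l + Γ.offset) (.inr ⟨i, k⟩) = Γ.residual i x k := by
  simp [Matrix.mulVec, dotProduct, Fintype.sum_sum_type, G, joint, offset, residual, sub_eq_add_neg]

/-- `F(z) = ‖G z + e‖²`. -/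
lemma gap_eq (x : Action n d) (l : DualVars m) :
    Γ.gap x l = (Γ.G *ᵥ joint x l + Γ.offset) ⬝ᵥ (Γ.G *ᵥ joint x l + Γ.offset) := by
  rw [dotProduct, Fintype.sum_sum_type, Fintype.sum_prod_type, Fintype.sum_sigma,
    ← Finset.sum_add_distrib, gap]
  refine Finset.sum_congr rfl fun i _ => ?_
  congr 1
  · rw [h, norm_toLp_sq]
    exact Finset.sum_congr rfl fun a _ => by rw [G_mulVec_inl]; rfl
  · rw [c, EuclideanSpace.real_norm_sq_eq]
    exact Finset.sum_congr rfl fun a _ => by rw [G_mulVec_inr, sq]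

lemma residual_and_ownGrad_of_eq_zero {x : Action n d} {l : DualVars m}
    (hz : Γ.G *ᵥ joint x l + Γ.offset = 0) (i : Fin n) :
    Γ.residual i x = 0 ∧ Γ.ownGrad i x (l i) = 0 := by
  refine ⟨?_, ?_⟩
  · ext k
    rw [← G_mulVec_inr Γ x l, hz]; rfl
  · funext a
    rw [← G_mulVec_inl, hz]; rfl

/-- The joint action with own block `v` of player `i` and zeros elsewhere, as a flat vector. -/
def embed (i : Fin n) (v : Fin d → ℝ) : Fin n × Fin d → ℝ :=
  fun p => if p.1 = i then v p.2 else 0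

lemma dotProduct_embed (i : Fin n) (w : Fin n × Fin d → ℝ) (v : Fin d → ℝ) :
    w ⬝ᵥ embed i v = (fun a => w (i, a)) ⬝ᵥ v := by
  rw [dotProduct, Fintype.sum_prod_type, Finset.sum_eq_single i]
  · simp [embed, dotProduct]
  · intro j _ hj; simp [embed, hj]
  · simp

lemma flat_update_add (x : Action n d) (i : Fin n) (v : EuclideanSpace ℝ (Fin d)) :
    flat (Function.update x i (x i + v)) = flat x + embed i v.ofLp := by
  funext ⟨j, a⟩
  by_cases hj : j = i
  · subst hj; simp [flat, embed]
  · simp [flat, embed, hj]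

lemma smul_embed (i : Fin n) (c : ℝ) (v : EuclideanSpace ℝ (Fin d)) :
    embed i (c • v).ofLp = c • embed i v.ofLp := by
  funext ⟨j, a⟩
  by_cases hj : j = i <;> simp [embed, hj]

lemma residual_update_add (i : Fin n) (x : Action n d) (v : EuclideanSpace ℝ (Fin d)) :
    Γ.residual i (Function.update x i (x i + v))
      = Γ.residual i x + WithLp.toLp 2 ((Γ.Aown i)ᵀ *ᵥ v.ofLp) := by
  ext k
  have h1 : (Γ.A i *ᵥ embed i v.ofLp) k = ((Γ.Aown i)ᵀ *ᵥ v.ofLp) k := by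
    rw [Matrix.mulVec, dotProduct_embed]; rfl
  simp only [residual, flat_update_add, Matrix.mulVec_add, PiLp.add_apply, Pi.sub_apply,
    Pi.add_apply, h1]
  ring

variable {Γ}

lemma Standing.H_apply (hΓ : Γ.Standing) (i : Fin n) (a : Fin d) (q : Fin n × Fin d) :
    Γ.H i a q = Γ.Q i (i, a) q := by
  simp only [H, Matrix.of_apply, (hΓ.symm i).eq, Matrix.add_apply]
  ring

/-- The exact second-order expansion of the cost of player `i` in the own action. -/
lemma Standing.cost_update_add (hΓ : Γ.Standing) (i : Fin n) (x : Action n d)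
    (v : EuclideanSpace ℝ (Fin d)) :
    Γ.cost i (Function.update x i (x i + v)) = Γ.cost i x
      + (Γ.H i *ᵥ flat x + fun a => Γ.r i (i, a)) ⬝ᵥ v.ofLp
      + (1 / 2) * (embed i v.ofLp ⬝ᵥ (Γ.Q i *ᵥ embed i v.ofLp)) := by
  have h1 : flat x ⬝ᵥ (Γ.Q i *ᵥ embed i v.ofLp) = (Γ.Q i *ᵥ flat x) ⬝ᵥ embed i v.ofLp := by
    rw [Matrix.dotProduct_mulVec, ← Matrix.mulVec_transpose, (hΓ.symm i).eq]
  have h2 : (Γ.H i *ᵥ flat x) ⬝ᵥ v.ofLp = (Γ.Q i *ᵥ flat x) ⬝ᵥ embed i v.ofLp := by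
    rw [dotProduct_embed]
    congr 1
    funext a
    simp only [Matrix.mulVec, dotProduct, hΓ.H_apply]
  have h3 : Γ.r i ⬝ᵥ embed i v.ofLp = (fun a => Γ.r i (i, a)) ⬝ᵥ v.ofLp := dotProduct_embed _ _ _
  simp only [cost, flat_update_add, Matrix.mulVec_add, dotProduct_add, add_dotProduct, h1, h2, h3,
    dotProduct_comm (embed i v.ofLp) (Γ.Q i *ᵥ flat x)]
  ring

lemma Standing.quadratic_nonneg (hΓ : Γ.Standing) (i : Fin n) (v : EuclideanSpace ℝ (Fin d)) :
    0 ≤ embed i v.ofLp ⬝ᵥ (Γ.Q i *ᵥ embed i v.ofLp) := by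
  -- Convexity at the midpoint of `v` and `-v`, around the origin.
  have hc := (hΓ.convex i 0).2 (Set.mem_univ ((0 : Action n d) i + v))
    (Set.mem_univ ((0 : Action n d) i + (-1 : ℝ) • v)) (by norm_num : (0 : ℝ) ≤ 1 / 2)
    (by norm_num : (0 : ℝ) ≤ 1 / 2) (by norm_num)
  have h0 : (1 / 2 : ℝ) • ((0 : Action n d) i + v)
        + (1 / 2 : ℝ) • ((0 : Action n d) i + (-1 : ℝ) • v)
      = (0 : Action n d) i + (0 : ℝ) • v := by
    simp
  simp only [h0, hΓ.cost_update_add, smul_embed] at hc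
  simp only [Matrix.mulVec_smul, smul_dotProduct, dotProduct_smul, smul_eq_mul, WithLp.ofLp_smul]
    at hc
  linarith

/-- A zero of the gap function is an equilibrium: it satisfies the optimality conditions of all the
players' convex programs. -/
lemma Standing.isGNE_of_eq_zero (hΓ : Γ.Standing) {x : Action n d} {l : DualVars m}
    (hz : Γ.G *ᵥ joint x l + Γ.offset = 0) : Γ.IsGNE x := by
  refine ⟨fun i => ?_, fun i y hy => ?_⟩
  · simpa [feasibleSet] using (Γ.residual_and_ownGrad_of_eq_zero hz i).1
  obtain ⟨hres, hgrad⟩ := Γ.residual_and_ownGrad_of_eq_zero hz i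
  have e : y = x i + (y - x i) := by abel
  set v := y - x i
  rw [feasibleSet, Set.mem_ofPred_eq, e, residual_update_add, hres, zero_add] at hy
  have hA : (Γ.Aown i)ᵀ *ᵥ v.ofLp = 0 := congrArg WithLp.ofLp hy
  have h1 : (Γ.H i *ᵥ flat x + fun a => Γ.r i (i, a)) ⬝ᵥ v.ofLp = 0 := by
    have h2 : (Γ.Aown i *ᵥ (l i).ofLp) ⬝ᵥ v.ofLp = 0 := by
      rw [dotProduct_comm, Matrix.dotProduct_mulVec, ← Matrix.mulVec_transpose, hA,
        zero_dotProduct]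
    have h3 : Γ.ownGrad i x (l i) ⬝ᵥ v.ofLp = 0 := by rw [hgrad, zero_dotProduct]
    rw [ownGrad, add_dotProduct, h2, add_zero] at h3
    exact h3
  rw [e, hΓ.cost_update_add, h1]
  linarith [hΓ.quadratic_nonneg i v]

lemma exists_mulVec_eq_of_orthogonal {p q : ℕ} (B : Matrix (Fin p) (Fin q) ℝ) (w : Fin p → ℝ)
    (hw : ∀ v : EuclideanSpace ℝ (Fin p), Bᵀ *ᵥ v.ofLp = 0 → w ⬝ᵥ v.ofLp = 0) :
    ∃ l : EuclideanSpace ℝ (Fin q), B *ᵥ l.ofLp = w := by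
  set T := Matrix.toEuclideanLin B with hT
  have h1 : (WithLp.toLp 2 w : EuclideanSpace ℝ (Fin p)) ∈ T.range := by
    rw [← Submodule.orthogonal_orthogonal T.range, Submodule.mem_orthogonal]
    intro v hv
    have h2 : Bᵀ *ᵥ v.ofLp = 0 := by
      have h3 : T.adjoint v = 0 := by
        refine ext_inner_left ℝ fun u => ?_
        rw [LinearMap.adjoint_inner_right, inner_zero_right]
        exact (Submodule.mem_orthogonal _ _).1 hv _ ⟨u, rfl⟩
      rw [hT, ← Matrix.toEuclideanLin_conjTranspose_eq_adjoint] at h3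
      simpa [Matrix.toLpLin_apply] using congrArg WithLp.ofLp h3
    have h4 := hw v h2
    rw [PiLp.inner_apply]
    simpa [dotProduct] using h4
  obtain ⟨l, hl⟩ := h1
  refine ⟨l, ?_⟩
  have := congrArg WithLp.ofLp hl
  simpa [hT, Matrix.toLpLin_apply] using this

/-- At an equilibrium there are multipliers: the own gradient is orthogonal to all feasible
directions, hence in the span of the constraint gradients. -/
lemma Standing.exists_multipliers (hΓ : Γ.Standing) {x : Action n d} (hx : Γ.IsGNE x) :
    ∃ l : DualVars m, Γ.G *ᵥ joint x l + Γ.offset = 0 := by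
  have hres : ∀ i, Γ.residual i x = 0 := fun i => by simpa [feasibleSet] using hx.1 i
  have hex : ∀ i, ∃ l : EuclideanSpace ℝ (Fin (m i)), Γ.Aown i *ᵥ l.ofLp
      = -(Γ.H i *ᵥ flat x + fun a => Γ.r i (i, a)) := by
    intro i
    refine exists_mulVec_eq_of_orthogonal _ _ fun v hv => ?_
    rw [neg_dotProduct, neg_eq_zero]
    set p := (Γ.H i *ᵥ flat x + fun a => Γ.r i (i, a)) ⬝ᵥ v.ofLp with hp
    set q := embed i v.ofLp ⬝ᵥ (Γ.Q i *ᵥ embed i v.ofLp) with hq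
    have hall : ∀ c : ℝ, 0 ≤ c * p + (1 / 2) * (c * (c * q)) := by
      intro c
      have hf : x i + c • v ∈ Γ.feasibleSet i x := by
        rw [feasibleSet, Set.mem_ofPred_eq, residual_update_add, hres, WithLp.ofLp_smul,
          Matrix.mulVec_smul, hv]
        simp
      have h1 := hx.2 i _ hf
      rw [hΓ.cost_update_add, smul_embed, WithLp.ofLp_smul, dotProduct_smul, Matrix.mulVec_smul,
        smul_dotProduct, dotProduct_smul] at h1
      simp only [smul_eq_mul] at h1
      linarith
    have hq0 : 0 ≤ q := hΓ.quadratic_nonneg i v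
    -- The quadratic `c p + c² q / 2` is negative at `c = -p / (q + 1)` unless `p = 0`.
    by_contra hp0
    have h1 := hall (-p / (q + 1))
    have h2 : -p / (q + 1) * p + (1 / 2) * (-p / (q + 1) * (-p / (q + 1) * q))
        = -(p ^ 2 * (q / 2 + 1) / (q + 1) ^ 2) := by
      field_simp; ring
    have h3 : 0 < p ^ 2 * (q / 2 + 1) / (q + 1) ^ 2 := by positivity
    linarith
  choose l hl using hex
  refine ⟨l, ?_⟩
  funext s
  rcases s with ⟨i, a⟩ | ⟨i, k⟩
  · rw [G_mulVec_inl, ownGrad, hl]; simp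
  · rw [G_mulVec_inr, hres]; rfl

end QuadGame

/-! ### Functions with finite moments of all orders -/

/-- All absolute moments of `f` are finite. This class contains the coordinates of a Gaussian
vector and is closed under sums and products, so it contains the polynomials in them. -/
def HasAllMoments {Ω : Type*} {mΩ : MeasurableSpace Ω} (f : Ω → ℝ) (μ : Measure Ω) : Prop :=
  ∀ p : NNReal, MemLp f p μ

namespace HasAllMoments

variable {Ω : Type*} {mΩ : MeasurableSpace Ω} {μ : Measure Ω} {f h : Ω → ℝ}

lemma const [IsFiniteMeasure μ] (c : ℝ) : HasAllMoments (fun _ => c) μ := fun _ => memLp_const c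

lemma add (hf : HasAllMoments f μ) (hh : HasAllMoments h μ) :
    HasAllMoments (fun ω => f ω + h ω) μ := fun p => (hf p).add (hh p)

lemma sub (hf : HasAllMoments f μ) (hh : HasAllMoments h μ) :
    HasAllMoments (fun ω => f ω - h ω) μ := fun p => (hf p).sub (hh p)

lemma mul (hf : HasAllMoments f μ) (hh : HasAllMoments h μ) :
    HasAllMoments (fun ω => f ω * h ω) μ := fun p => by
  have : ENNReal.HolderTriple ((2 * p : NNReal) : ENNReal) ((2 * p : NNReal) : ENNReal) p := ⟨by
    push_cast
    rw [ENNReal.mul_inv (by simp) (by simp), ← add_mul, ENNReal.inv_two_add_inv_two, one_mul]⟩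
  exact (hh (2 * p)).mul' (hf (2 * p))

lemma const_mul (c : ℝ) (hf : HasAllMoments f μ) : HasAllMoments (fun ω => c * f ω) μ :=
  fun p => (hf p).const_mul c

lemma sum {ι : Type*} (s : Finset ι) {f : ι → Ω → ℝ} (hf : ∀ i, HasAllMoments (f i) μ) :
    HasAllMoments (fun ω => ∑ i ∈ s, f i ω) μ := fun p => memLp_finsetSum _ fun i _ => hf i p

lemma integrable (hf : HasAllMoments f μ) : Integrable f μ :=
  memLp_one_iff_integrable.1 (by exact_mod_cast hf 1)

lemma memLp_two (hf : HasAllMoments f μ) : MemLp f 2 μ := by exact_mod_cast hf 2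

end HasAllMoments

/-! ### Moments of standard Gaussian vectors -/

/-- The law of a vector of independent standard normal variables. -/
noncomputable abbrev stdNormal (ι : Type*) [Fintype ι] : Measure (ι → ℝ) :=
  Measure.pi fun _ => gaussianReal 0 1

lemma integral_pow_gaussianReal_of_odd {k : ℕ} (hk : Odd k) :
    ∫ x, x ^ k ∂(gaussianReal 0 1) = 0 := by
  have h1 : ∫ x, x ^ k ∂((gaussianReal 0 1).map fun x => -x) = ∫ x, (-x) ^ k ∂(gaussianReal 0 1) :=
    integral_map (by fun_prop) (by fun_prop)
  rw [gaussianReal_map_neg, neg_zero] at h1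
  simp_rw [hk.neg_pow] at h1
  rw [integral_neg] at h1
  linarith

lemma integral_sq_gaussianReal : ∫ x, x ^ 2 ∂(gaussianReal 0 1) = 1 := by
  have h := variance_fun_id_gaussianReal (μ := 0) (v := 1)
  rw [variance_eq_integral (by fun_prop)] at h
  simpa using h

lemma integral_pow_four_gaussianReal : ∫ x, x ^ 4 ∂(gaussianReal 0 1) = 3 := by
  have h1 : ∫ x, x ^ 4 ∂(gaussianReal 0 1)
      = iteratedDeriv 4 (mgf (fun x => x) (gaussianReal 0 1)) 0 := by
    rw [iteratedDeriv_mgf_zero] <;> simp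
  have hE : ∀ t : ℝ, HasDerivAt (fun t => Real.exp (t ^ 2 / 2)) (t * Real.exp (t ^ 2 / 2)) t := by
    intro t
    have := ((hasDerivAt_pow 2 t).div_const 2).exp
    convert this using 1
    ring
  have step : ∀ p p' q : ℝ → ℝ, (∀ t, HasDerivAt p (p' t) t) → (∀ t, p' t + t * p t = q t) →
      deriv (fun t => p t * Real.exp (t ^ 2 / 2)) = fun t => q t * Real.exp (t ^ 2 / 2) := by
    intro p p' q hp hq
    funext t
    rw [((hp t).fun_mul (hE t)).deriv, ← hq]
    ring
  have e : (fun t : ℝ => Real.exp (0 * t + ((1 : NNReal) : ℝ) * t ^ 2 / 2))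
      = fun t => (fun _ => (1 : ℝ)) t * Real.exp (t ^ 2 / 2) := by
    funext t; simp
  have d1 : ∀ t : ℝ, HasDerivAt (fun t : ℝ => t ^ 2 + 1) (2 * t) t := fun t => by
    simpa using (hasDerivAt_pow 2 t).add_const 1
  have d2 : ∀ t : ℝ, HasDerivAt (fun t : ℝ => t ^ 3 + 3 * t) (3 * t ^ 2 + 3) t := fun t => by
    simpa using (hasDerivAt_pow 3 t).fun_add ((hasDerivAt_id t).const_mul 3)
  rw [h1, mgf_fun_id_gaussianReal]
  simp only [e]
  rw [iteratedDeriv_succ', iteratedDeriv_succ', iteratedDeriv_succ', iteratedDeriv_succ',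
    iteratedDeriv_zero,
    step _ (fun _ => 0) (fun t => t) (fun t => hasDerivAt_const t 1) (fun t => by ring),
    step (fun t => t) (fun _ => 1) (fun t => t ^ 2 + 1) (fun t => hasDerivAt_id t)
      (fun t => by ring),
    step _ (fun t => 2 * t) (fun t => t ^ 3 + 3 * t) d1 (fun t => by ring),
    step _ (fun t => 3 * t ^ 2 + 3) (fun t => t ^ 4 + 6 * t ^ 2 + 3) d2 (fun t => by ring)]
  simp

section Moments

variable {ι : Type*} [Fintype ι]

lemma hasAllMoments_eval (a : ι) : HasAllMoments (fun x : ι → ℝ => x a) (stdNormal ι) := fun p =>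
  (memLp_id_gaussianReal p).comp_measurePreserving (measurePreserving_eval _ a)

/-- A monomial integrates to the product of the one-dimensional moments. -/
lemma integral_monomial (e : ι → ℕ) :
    ∫ x, ∏ k, x k ^ e k ∂(stdNormal ι) = ∏ k, ∫ x, x ^ e k ∂(gaussianReal 0 1) :=
  integral_fintype_prod_eq_prod (μ := fun _ : ι => gaussianReal 0 1) fun k x => x ^ e k

lemma integral_monomial_of_odd {e : ι → ℕ} {k : ι} (hk : Odd (e k)) :
    ∫ x, ∏ k, x k ^ e k ∂(stdNormal ι) = 0 := by
  rw [integral_monomial]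
  exact Finset.prod_eq_zero (Finset.mem_univ k) (integral_pow_gaussianReal_of_odd hk)

variable [DecidableEq ι]

lemma prod_pow_ite (x : ι → ℝ) (a : ι) : ∏ k, x k ^ (if k = a then 1 else 0) = x a := by
  simp [pow_ite, Finset.prod_ite_eq']

lemma integral_mul_eval (a b : ι) :
    ∫ x, x a * x b ∂(stdNormal ι) = if a = b then 1 else 0 := by
  have e : ∀ x : ι → ℝ, x a * x b
      = ∏ k, x k ^ ((if k = a then 1 else 0) + if k = b then 1 else 0) := by
    intro x
    simp_rw [pow_add, Finset.prod_mul_distrib, prod_pow_ite]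
  simp_rw [e]
  split_ifs with hab
  · subst hab
    rw [integral_monomial, Finset.prod_eq_one]
    intro k _
    split_ifs with hk
    · exact integral_sq_gaussianReal
    · simp
  · exact integral_monomial_of_odd (k := a) (by simp [hab])

lemma integral_mul_mul_eval (a b c : ι) : ∫ x, x a * x b * x c ∂(stdNormal ι) = 0 := by
  have e : ∀ x : ι → ℝ, x a * x b * x c = ∏ k, x k ^ ((if k = a then 1 else 0)
      + (if k = b then 1 else 0) + if k = c then 1 else 0) := by
    intro x
    simp_rw [pow_add, Finset.prod_mul_distrib, prod_pow_ite]
  simp_rw [e]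
  by_cases hab : a = b
  · by_cases hac : a = c
    · exact integral_monomial_of_odd (k := a) (by simp [← hab, ← hac]; decide)
    · exact integral_monomial_of_odd (k := c) (by simp [← hab, Ne.symm hac])
  · by_cases hac : a = c
    · exact integral_monomial_of_odd (k := b) (by simp [← hac, Ne.symm hab])
    · exact integral_monomial_of_odd (k := a) (by simp [hab, hac])

lemma integral_mul_mul_sq_eval (a b c : ι) :
    ∫ x, x a * x b * x c ^ 2 ∂(stdNormal ι)
      = if a = b then (if a = c then 3 else 1) else 0 := by
  have e : ∀ x : ι → ℝ, x a * x b * x c ^ 2 = ∏ k, x k ^ ((if k = a then 1 else 0)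
      + (if k = b then 1 else 0) + ((if k = c then 1 else 0) + if k = c then 1 else 0)) := by
    intro x
    simp_rw [pow_add, Finset.prod_mul_distrib, prod_pow_ite, sq]
  simp_rw [e]
  split_ifs with hab hac
  · subst hab hac
    rw [integral_monomial, Finset.prod_eq_single a]
    · simpa using integral_pow_four_gaussianReal
    · intro k _ hk; simp [hk]
    · simp
  · subst hab
    rw [integral_monomial, Finset.prod_eq_one]
    intro k _
    by_cases h1 : k = a
    · subst h1; simpa [hac] using integral_sq_gaussianReal
    · by_cases h2 : k = c
      · subst h2; simpa [h1] using integral_sq_gaussianReal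
      · simp [h1, h2]
  · refine integral_monomial_of_odd (k := a) ?_
    by_cases hac : a = c
    · simp [hab, ← hac]; decide
    · simp [hab, hac]

/-- The weight `x_c² - 1` extracts the `c`-th diagonal entry of a quadratic form. -/
lemma integral_mul_mul_sq_sub_one (a b c : ι) :
    ∫ x, x a * x b * (x c ^ 2 - 1) ∂(stdNormal ι) = if a = c ∧ b = c then 2 else 0 := by
  have hm : ∀ a, HasAllMoments (fun x : ι → ℝ => x a) (stdNormal ι) := hasAllMoments_eval
  have h1 : Integrable (fun x : ι → ℝ => x a * x b * x c ^ 2) (stdNormal ι) := by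
    simp_rw [sq]
    exact (((hm a).mul (hm b)).mul ((hm c).mul (hm c))).integrable
  have h2 : Integrable (fun x : ι → ℝ => x a * x b) (stdNormal ι) := ((hm a).mul (hm b)).integrable
  simp_rw [mul_sub, mul_one]
  rw [integral_sub h1 h2, integral_mul_mul_sq_eval, integral_mul_eval]
  by_cases hab : a = b
  · subst hab
    by_cases hac : a = c
    · norm_num [hac]
    · simp [hac]
  · have : ¬(a = c ∧ b = c) := fun h => hab (h.1.trans h.2.symm)
    simp [hab, this]

end Moments

/-! ### The gradient estimate as a polynomial in the directions -/

/-- Indices of the coordinates of `z = [x, λ]`. -/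
abbrev JointIndex {n : ℕ} (d : ℕ) (m : Fin n → ℕ) := (Fin n × Fin d) ⊕ (Σ i, Fin (m i))

/-- The coordinates of the directions of one step: those of `[ξ, ν]`, and those of `η`. -/
abbrev Directions {n : ℕ} (d : ℕ) (m : Fin n → ℕ) :=
  (JointIndex d m → ℝ) × (Fin n × Fin d → ℝ)

/-- The standard Gaussian law of the directions of one step. -/
noncomputable abbrev directionLaw {n : ℕ} (d : ℕ) (m : Fin n → ℕ) : Measure (Directions d m) :=
  (stdNormal (JointIndex d m)).prod (stdNormal (Fin n × Fin d))

namespace QuadGame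

variable {n d : ℕ} {m : Fin n → ℕ} (Γ : QuadGame n d m)

/-- The linear part of the gradient of `L_j` in all the actions, as a function of `z = [x, λ]`. -/
def lagMatrix (j : Fin n) : Matrix (Fin n × Fin d) (JointIndex d m) ℝ :=
  Matrix.fromCols (Γ.Q j) (Matrix.of fun p s => if s.1 = j then Γ.A s.1 s.2 p else 0)

lemma lagMatrix_mulVec (j : Fin n) (x : Action n d) (l : DualVars m) :
    Γ.lagMatrix j *ᵥ joint x l = Γ.Q j *ᵥ flat x + (Γ.A j)ᵀ *ᵥ (l j).ofLp := by
  rw [lagMatrix, joint, Matrix.fromCols_mulVec_sumElim]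
  congr 1
  funext p
  simp only [Matrix.mulVec, dotProduct, Matrix.of_apply, Matrix.transpose_apply]
  rw [Fintype.sum_sigma, Finset.sum_eq_single j]
  · simp
  · intro i _ hi; simp [hi]
  · simp

lemma flat_add (x y : Action n d) : flat (x + y) = flat x + flat y := rfl

lemma flat_sub (x y : Action n d) : flat (x - y) = flat x - flat y := rfl

lemma flat_smul (c : ℝ) (x : Action n d) : flat (c • x) = c • flat x := rfl

lemma joint_add_smul (x ξ : Action n d) (l ν : DualVars m) (δ : ℝ) :
    joint (x + δ • ξ) (l + δ • ν) = joint x l + δ • joint ξ ν := by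
  funext s
  rcases s with p | s <;> rfl

variable {Γ} in
/-- Central differences of quadratic functions are exact directional derivatives. -/
lemma Standing.Delta1_eq (hΓ : Γ.Standing) {σ : ℝ} (hσ : 0 < σ) (x : Action n d) (l : DualVars m)
    (η : Action n d) (i : Fin n) :
    Γ.Delta1 σ x l η i = (Γ.lagMatrix i *ᵥ joint x l + Γ.r i) ⬝ᵥ flat η := by
  have h1 : flat x ⬝ᵥ (Γ.Q i *ᵥ flat η) = (Γ.Q i *ᵥ flat x) ⬝ᵥ flat η := by
    rw [Matrix.dotProduct_mulVec, ← Matrix.mulVec_transpose, (hΓ.symm i).eq]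
  have h2 : (Γ.A i *ᵥ flat η) ⬝ᵥ (l i).ofLp = ((Γ.A i)ᵀ *ᵥ (l i).ofLp) ⬝ᵥ flat η := by
    rw [dotProduct_comm, Matrix.dotProduct_mulVec, ← Matrix.mulVec_transpose]
  have hin : ∀ v : Fin (m i) → ℝ, ⟪l i, WithLp.toLp 2 v⟫ = v ⬝ᵥ (l i).ofLp := by
    intro v
    rw [EuclideanSpace.inner_eq_star_dotProduct]
    simp
  rw [Delta1, div_eq_iff (by positivity), lagMatrix_mulVec]
  simp only [lagrangian, cost, residual, hin, flat_add, flat_sub, flat_smul, Matrix.mulVec_add,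
    Matrix.mulVec_sub, Matrix.mulVec_smul, dotProduct_add, dotProduct_sub, add_dotProduct,
    sub_dotProduct, smul_dotProduct, dotProduct_smul, smul_eq_mul, h1, h2,
    dotProduct_comm (flat η) (Γ.Q i *ᵥ flat x)]
  ring

lemma Delta3_eq {σ : ℝ} (hσ : 0 < σ) (x η : Action n d) (i : Fin n) :
    Γ.Delta3 σ x η i = 2 * ∑ k, Γ.residual i x k * (Γ.A i k ⬝ᵥ flat η) := by
  have hres : ∀ c : ℝ, ∀ k, Γ.residual i (x + c • η) k
      = Γ.residual i x k + c * (Γ.A i k ⬝ᵥ flat η) := by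
    intro c k
    simp only [residual, flat_add, flat_smul, Matrix.mulVec_add, Matrix.mulVec_smul,
      Pi.sub_apply, Pi.add_apply, Pi.smul_apply, smul_eq_mul]
    have h1 : (Γ.A i *ᵥ flat η) k = Γ.A i k ⬝ᵥ flat η := rfl
    rw [h1]
    ring
  have hsub : x - σ • η = x + (-σ) • η := by rw [neg_smul, sub_eq_add_neg]
  rw [Delta3, div_eq_iff (by positivity), hsub, c, c, EuclideanSpace.real_norm_sq_eq,
    EuclideanSpace.real_norm_sq_eq, ← Finset.sum_sub_distrib, Finset.mul_sum, Finset.sum_mul]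
  refine Finset.sum_congr rfl fun k _ => ?_
  rw [hres, hres]
  ring

/-- The weight `‖η^j‖² - d` of player `j`, centered so that it filters out the blocks of the
other players. -/
def weight (j : Fin n) (y : Fin n × Fin d → ℝ) : ℝ := ∑ a, (y (j, a) ^ 2 - 1)

lemma weight_flat (j : Fin n) (η : Action n d) : weight j (flat η) = ‖η j‖ ^ 2 - d := by
  rw [EuclideanSpace.real_norm_sq_eq, weight, Finset.sum_sub_distrib]
  simp [flat]

variable {Γ} in
lemma Standing.message_eq (hΓ : Γ.Standing) {σ δ : ℝ} (hσ : 0 < σ) (hδ : 0 < δ) (x : Action n d)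
    (l : DualVars m) (ξ : Action n d) (ν : DualVars m) (η : Action n d) (j : Fin n) :
    Γ.message σ δ x l ξ ν η j
      = weight j (flat η) * ((Γ.lagMatrix j *ᵥ joint x l + Γ.r j) ⬝ᵥ flat η)
          * ((Γ.lagMatrix j *ᵥ joint ξ ν) ⬝ᵥ flat η)
        + δ / 2 * (weight j (flat η) * ((Γ.lagMatrix j *ᵥ joint ξ ν) ⬝ᵥ flat η) ^ 2) := by
  have h2 : Γ.Delta2 σ δ x l ξ ν η j = (Γ.lagMatrix j *ᵥ joint x l + Γ.r j) ⬝ᵥ flat η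
      + δ * ((Γ.lagMatrix j *ᵥ joint ξ ν) ⬝ᵥ flat η) := by
    have : Γ.Delta2 σ δ x l ξ ν η j = Γ.Delta1 σ (x + δ • ξ) (l + δ • ν) η j := rfl
    rw [this, hΓ.Delta1_eq hσ, joint_add_smul, Matrix.mulVec_add, Matrix.mulVec_smul]
    simp only [add_dotProduct, smul_dotProduct, smul_eq_mul]
    ring
  rw [message, S2, S1, h2, hΓ.Delta1_eq hσ, weight_flat]
  field_simp
  ring

/-- Which messages enter the coordinate `c` of the update: all of them for an action, the own one
for a dual variable. -/
def share (c : JointIndex d m) (j : Fin n) : ℝ :=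
  Sum.elim (fun _ => 1) (fun s => if s.1 = j then 1 else 0) c

/-- The part of the gradient estimate that is linear in the Lagrangian gradients `p` and in the
residuals `ρ` at the current point. -/
def linEst (p : Fin n → Fin n × Fin d → ℝ) (ρ : (Σ i, Fin (m i)) → ℝ) (c : JointIndex d m)
    (u : Directions d m) : ℝ :=
  (∑ j, share c j * (weight j u.2 * (p j ⬝ᵥ u.2) * ((Γ.lagMatrix j *ᵥ u.1) ⬝ᵥ u.2)) * u.1 c)
    + Sum.elim (fun q => (2 * ∑ s, ρ s * (Γ.A s.1 s.2 ⬝ᵥ u.2)) * u.2 q) (fun _ => 0) c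

/-- The part of the gradient estimate that does not depend on the current point. -/
noncomputable def quadEst (δ : ℝ) (c : JointIndex d m) (u : Directions d m) : ℝ :=
  ∑ j, share c j * (δ / 2 * (weight j u.2 * ((Γ.lagMatrix j *ᵥ u.1) ⬝ᵥ u.2) ^ 2)) * u.1 c

variable {Γ} in
lemma Standing.joint_zeta_eq (hΓ : Γ.Standing) {σ δ : ℝ} (hσ : 0 < σ) (hδ : 0 < δ)
    (x : Action n d) (l : DualVars m) (ξ : Action n d) (ν : DualVars m) (η : Action n d)
    (c : JointIndex d m) :
    joint (Γ.zetaX σ δ x l ξ ν η) (Γ.zetaDual σ δ x l ξ ν η) c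
      = Γ.linEst (fun j => Γ.lagMatrix j *ᵥ joint x l + Γ.r j) (fun s => Γ.residual s.1 x s.2) c
          (joint ξ ν, flat η) + Γ.quadEst δ c (joint ξ ν, flat η) := by
  rcases c with ⟨i, a⟩ | ⟨i, k⟩
  · have h1 : joint (Γ.zetaX σ δ x l ξ ν η) (Γ.zetaDual σ δ x l ξ ν η) (.inl (i, a))
        = (∑ j, Γ.message σ δ x l ξ ν η j) * ξ i a + (∑ j, Γ.Delta3 σ x η j) * η i a := by
      simp [joint, flat, zetaX]
    have h2 : ∑ j, Γ.Delta3 σ x η j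
        = 2 * ∑ s : Σ i, Fin (m i), Γ.residual s.1 x s.2 * (Γ.A s.1 s.2 ⬝ᵥ flat η) := by
      simp_rw [Γ.Delta3_eq hσ]
      rw [← Finset.mul_sum, Fintype.sum_sigma]
    rw [h1, h2, linEst, quadEst, add_right_comm, ← Finset.sum_add_distrib, Finset.sum_mul]
    congr 1
    refine Finset.sum_congr rfl fun j _ => ?_
    rw [hΓ.message_eq hσ hδ]
    simp only [share, Sum.elim_inl, joint, flat]
    ring
  · have h1 : joint (Γ.zetaX σ δ x l ξ ν η) (Γ.zetaDual σ δ x l ξ ν η) (.inr ⟨i, k⟩)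
        = Γ.message σ δ x l ξ ν η i * ν i k := by
      simp [joint, zetaDual]
    rw [h1, linEst, quadEst, Finset.sum_eq_single i, Finset.sum_eq_single i, hΓ.message_eq hσ hδ]
    · simp only [share, Sum.elim_inr, joint]
      simp only [if_true]
      ring
    · intro j _ hj; simp [share, Ne.symm hj]
    · simp
    · intro j _ hj; simp [share, Ne.symm hj]
    · simp

lemma linEst_add_smul (p p' : Fin n → Fin n × Fin d → ℝ) (ρ ρ' : (Σ i, Fin (m i)) → ℝ) (t : ℝ)
    (c : JointIndex d m) (u : Directions d m) :
    Γ.linEst (p + t • p') (ρ + t • ρ') c u = Γ.linEst p ρ c u + t * Γ.linEst p' ρ' c u := by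
  have h1 : ∑ j, share c j * (weight j u.2 * ((p + t • p') j ⬝ᵥ u.2)
        * ((Γ.lagMatrix j *ᵥ u.1) ⬝ᵥ u.2)) * u.1 c
      = (∑ j, share c j * (weight j u.2 * (p j ⬝ᵥ u.2)
        * ((Γ.lagMatrix j *ᵥ u.1) ⬝ᵥ u.2)) * u.1 c)
        + t * ∑ j, share c j * (weight j u.2 * (p' j ⬝ᵥ u.2)
        * ((Γ.lagMatrix j *ᵥ u.1) ⬝ᵥ u.2)) * u.1 c := by
    rw [Finset.mul_sum, ← Finset.sum_add_distrib]
    refine Finset.sum_congr rfl fun j _ => ?_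
    rw [Pi.add_apply, Pi.smul_apply, add_dotProduct, smul_dotProduct, smul_eq_mul]
    ring
  have h2 : ∑ s, (ρ + t • ρ') s * (Γ.A s.1 s.2 ⬝ᵥ u.2)
      = (∑ s, ρ s * (Γ.A s.1 s.2 ⬝ᵥ u.2)) + t * ∑ s, ρ' s * (Γ.A s.1 s.2 ⬝ᵥ u.2) := by
    rw [Finset.mul_sum, ← Finset.sum_add_distrib]
    refine Finset.sum_congr rfl fun j _ => ?_
    rw [Pi.add_apply, Pi.smul_apply, smul_eq_mul]
    ring
  rw [linEst, linEst, linEst, h1, h2]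
  rcases c with q | s
  · simp only [Sum.elim_inl]; ring
  · simp only [Sum.elim_inr]; ring

lemma linEst_add_sum {β : Type*} (T : Finset β) (p : Fin n → Fin n × Fin d → ℝ)
    (p' : β → Fin n → Fin n × Fin d → ℝ) (ρ : (Σ i, Fin (m i)) → ℝ)
    (ρ' : β → (Σ i, Fin (m i)) → ℝ) (v : β → ℝ) (c : JointIndex d m) (u : Directions d m) :
    Γ.linEst (p + ∑ b ∈ T, v b • p' b) (ρ + ∑ b ∈ T, v b • ρ' b) c u
      = Γ.linEst p ρ c u + ∑ b ∈ T, Γ.linEst (p' b) (ρ' b) c u * v b := by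
  classical
  induction T using Finset.induction_on with
  | empty => simp
  | insert b T hb ih =>
    rw [Finset.sum_insert hb, Finset.sum_insert hb, Finset.sum_insert hb, add_comm (v b • p' b),
      add_comm (v b • ρ' b), ← add_assoc, ← add_assoc, linEst_add_smul, ih]
    ring

/-! ### Moments of the gradient estimate -/

lemma hasAllMoments_fst (c : JointIndex d m) :
    HasAllMoments (fun u : Directions d m => u.1 c) (directionLaw d m) := fun p =>
  (hasAllMoments_eval c p).comp_measurePreserving measurePreserving_fst

lemma hasAllMoments_snd (q : Fin n × Fin d) :
    HasAllMoments (fun u : Directions d m => u.2 q) (directionLaw d m) := fun p =>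
  (hasAllMoments_eval q p).comp_measurePreserving measurePreserving_snd

lemma hasAllMoments_dotProduct_snd (w : Fin n × Fin d → ℝ) :
    HasAllMoments (fun u : Directions d m => w ⬝ᵥ u.2) (directionLaw d m) :=
  HasAllMoments.sum _ fun q => (hasAllMoments_snd q).const_mul _

lemma hasAllMoments_weight (j : Fin n) :
    HasAllMoments (fun u : Directions d m => weight j u.2) (directionLaw d m) :=
  HasAllMoments.sum _ fun a => by
    simp_rw [sq]
    exact ((hasAllMoments_snd _).mul (hasAllMoments_snd _)).sub (.const 1)

lemma hasAllMoments_bilinear (j : Fin n) :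
    HasAllMoments (fun u : Directions d m => (Γ.lagMatrix j *ᵥ u.1) ⬝ᵥ u.2) (directionLaw d m) :=
  HasAllMoments.sum _ fun q => HasAllMoments.mul
    (HasAllMoments.sum _ fun c => (hasAllMoments_fst c).const_mul _) (hasAllMoments_snd q)

lemma hasAllMoments_linEst (p : Fin n → Fin n × Fin d → ℝ) (ρ : (Σ i, Fin (m i)) → ℝ)
    (c : JointIndex d m) : HasAllMoments (Γ.linEst p ρ c) (directionLaw d m) := by
  refine HasAllMoments.add (HasAllMoments.sum _ fun j => HasAllMoments.mul
    ((((hasAllMoments_weight j).mul (hasAllMoments_dotProduct_snd _)).mul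
      (Γ.hasAllMoments_bilinear j)).const_mul _) (hasAllMoments_fst c)) ?_
  rcases c with q | s
  · exact ((HasAllMoments.sum _ fun s =>
      (hasAllMoments_dotProduct_snd _).const_mul _).const_mul 2).mul (hasAllMoments_snd q)
  · exact .const 0

lemma hasAllMoments_quadEst (δ : ℝ) (c : JointIndex d m) :
    HasAllMoments (Γ.quadEst δ c) (directionLaw d m) := by
  refine HasAllMoments.sum _ fun j => HasAllMoments.mul
    (HasAllMoments.const_mul _ (HasAllMoments.const_mul _ ?_)) (hasAllMoments_fst c)
  simp_rw [sq]
  exact (hasAllMoments_weight j).mul ((Γ.hasAllMoments_bilinear j).mul (Γ.hasAllMoments_bilinear j))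

lemma measurable_linEst (p : Fin n → Fin n × Fin d → ℝ) (ρ : (Σ i, Fin (m i)) → ℝ)
    (c : JointIndex d m) : Measurable (Γ.linEst p ρ c) := by
  unfold linEst weight Matrix.mulVec dotProduct
  rcases c with q | s
  · simp only [Sum.elim_inl]; fun_prop
  · simp only [Sum.elim_inr]; fun_prop

lemma measurable_quadEst (δ : ℝ) (c : JointIndex d m) : Measurable (Γ.quadEst δ c) := by
  unfold quadEst weight Matrix.mulVec dotProduct
  fun_prop

lemma integral_dotProduct_mul_eval (w : Fin n × Fin d → ℝ) (q : Fin n × Fin d) :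
    ∫ y, (w ⬝ᵥ y) * y q ∂(stdNormal (Fin n × Fin d)) = w q := by
  have e : ∀ y : Fin n × Fin d → ℝ, (w ⬝ᵥ y) * y q = ∑ p, w p * (y p * y q) := by
    intro y
    rw [dotProduct, Finset.sum_mul]
    exact Finset.sum_congr rfl fun p _ => by ring
  simp_rw [e]
  rw [integral_finsetSum _ fun p _ =>
    (((hasAllMoments_eval p).mul (hasAllMoments_eval q)).const_mul _).integrable]
  simp_rw [integral_const_mul, integral_mul_eval]
  simp

/-- The weight `‖η^j‖² - d` extracts twice the own block `j` of the inner product. -/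
lemma integral_weight_mul (j : Fin n) (v w : Fin n × Fin d → ℝ) :
    ∫ y, weight j y * (v ⬝ᵥ y) * (w ⬝ᵥ y) ∂(stdNormal (Fin n × Fin d))
      = 2 * ∑ a, v (j, a) * w (j, a) := by
  have e : ∀ y : Fin n × Fin d → ℝ, weight j y * (v ⬝ᵥ y) * (w ⬝ᵥ y)
      = ∑ a, ∑ p, ∑ q, v p * w q * (y p * y q * (y (j, a) ^ 2 - 1)) := by
    intro y
    rw [weight, dotProduct, dotProduct, Finset.sum_mul, Finset.sum_mul]
    refine Finset.sum_congr rfl fun a _ => ?_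
    rw [mul_assoc, Finset.sum_mul_sum, Finset.mul_sum]
    refine Finset.sum_congr rfl fun p _ => ?_
    rw [Finset.mul_sum]
    exact Finset.sum_congr rfl fun q _ => by ring
  have hi : ∀ a p q, Integrable (fun y : Fin n × Fin d → ℝ =>
      v p * w q * (y p * y q * (y (j, a) ^ 2 - 1))) (stdNormal (Fin n × Fin d)) := by
    intro a p q
    simp_rw [sq]
    exact (HasAllMoments.const_mul _ (((hasAllMoments_eval p).mul (hasAllMoments_eval q)).mul
      (((hasAllMoments_eval (j, a)).mul (hasAllMoments_eval (j, a))).sub (.const 1)))).integrable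
  simp_rw [e]
  rw [integral_finsetSum _ fun a _ => integrable_finsetSum _ fun p _ =>
    integrable_finsetSum _ fun q _ => hi a p q, Finset.mul_sum]
  refine Finset.sum_congr rfl fun a _ => ?_
  rw [integral_finsetSum _ fun p _ => integrable_finsetSum _ fun q _ => hi a p q,
    Finset.sum_eq_single (j, a), integral_finsetSum _ fun q _ => hi a _ q,
    Finset.sum_eq_single (j, a)]
  · rw [integral_const_mul, integral_mul_mul_sq_sub_one]
    simp; ring
  · intro q _ hq
    rw [integral_const_mul, integral_mul_mul_sq_sub_one]
    simp [hq]
  · simp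
  · intro p _ hp
    rw [integral_finsetSum _ fun q _ => hi a _ q]
    refine Finset.sum_eq_zero fun q _ => ?_
    rw [integral_const_mul, integral_mul_mul_sq_sub_one]
    simp [hp]
  · simp

lemma bilinear_eq_sum (B : Matrix (Fin n × Fin d) (JointIndex d m) ℝ) (u : Directions d m) :
    (B *ᵥ u.1) ⬝ᵥ u.2 = ∑ c, u.1 c * ((fun q => B q c) ⬝ᵥ u.2) := by
  simp only [Matrix.mulVec, dotProduct, Finset.sum_mul, Finset.mul_sum]
  rw [Finset.sum_comm]
  exact Finset.sum_congr rfl fun c _ => Finset.sum_congr rfl fun q _ => by ring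

lemma integral_weight_term (j : Fin n) (v : Fin n × Fin d → ℝ) (c : JointIndex d m) :
    ∫ u, weight j u.2 * (v ⬝ᵥ u.2) * ((Γ.lagMatrix j *ᵥ u.1) ⬝ᵥ u.2) * u.1 c ∂(directionLaw d m)
      = 2 * ∑ a, v (j, a) * Γ.lagMatrix j (j, a) c := by
  have e : ∀ u : Directions d m,
      weight j u.2 * (v ⬝ᵥ u.2) * ((Γ.lagMatrix j *ᵥ u.1) ⬝ᵥ u.2) * u.1 c
      = ∑ f, (u.1 f * u.1 c) *
        (weight j u.2 * (v ⬝ᵥ u.2) * ((fun q => Γ.lagMatrix j q f) ⬝ᵥ u.2)) := by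
    intro u
    rw [bilinear_eq_sum, Finset.mul_sum, Finset.sum_mul]
    exact Finset.sum_congr rfl fun f _ => by ring
  simp_rw [e]
  rw [integral_finsetSum _ fun f _ => (((hasAllMoments_fst f).mul (hasAllMoments_fst c)).mul
    (((hasAllMoments_weight j).mul (hasAllMoments_dotProduct_snd v)).mul
      (hasAllMoments_dotProduct_snd _))).integrable, Finset.sum_eq_single c]
  · rw [integral_prod_mul (fun θ : JointIndex d m → ℝ => θ c * θ c)
      (fun y => weight j y * (v ⬝ᵥ y) * ((fun q => Γ.lagMatrix j q c) ⬝ᵥ y)),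
      integral_mul_eval, integral_weight_mul]
    simp
  · intro f _ hf
    rw [integral_prod_mul (fun θ : JointIndex d m → ℝ => θ f * θ c)
      (fun y => weight j y * (v ⬝ᵥ y) * ((fun q => Γ.lagMatrix j q f) ⬝ᵥ y)),
      integral_mul_eval]
    simp [hf]
  · simp

lemma G_inl_apply_eq {Γ : QuadGame n d m} (hΓ : Γ.Standing) (j : Fin n) (a : Fin d)
    (c : JointIndex d m) : Γ.G (.inl (j, a)) c = Γ.lagMatrix j (j, a) c := by
  rcases c with q | s
  · simp [G, lagMatrix, hΓ.H_apply]
  · by_cases hs : s.1 = j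
    · subst hs; simp [G, lagMatrix, Aown]
    · simp [G, lagMatrix, hs]

/-- The linear part of the gradient estimate is unbiased: it has the mean of the gradient of the
gap function, `2 Gᵀ` applied to the own-block gradients and the residuals. -/
lemma Standing.integral_linEst {Γ : QuadGame n d m} (hΓ : Γ.Standing)
    (p : Fin n → Fin n × Fin d → ℝ) (ρ : (Σ i, Fin (m i)) → ℝ) (c : JointIndex d m) :
    ∫ u, Γ.linEst p ρ c u ∂(directionLaw d m)
      = 2 * ∑ f, Γ.G f c * Sum.elim (fun q : Fin n × Fin d => p q.1 q) ρ f := by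
  have h1 : ∫ u : Directions d m, (∑ j, share c j * (weight j u.2 * (p j ⬝ᵥ u.2)
        * ((Γ.lagMatrix j *ᵥ u.1) ⬝ᵥ u.2)) * u.1 c) ∂(directionLaw d m)
      = 2 * ∑ q : Fin n × Fin d, Γ.G (.inl q) c * p q.1 q := by
    simp_rw [mul_assoc (share c _)]
    rw [integral_finsetSum _ fun j _ => HasAllMoments.integrable <| HasAllMoments.const_mul _ <|
      ((((hasAllMoments_weight j).mul (hasAllMoments_dotProduct_snd _)).mul
      (Γ.hasAllMoments_bilinear j)).mul (hasAllMoments_fst c)), Fintype.sum_prod_type,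
      Finset.mul_sum]
    refine Finset.sum_congr rfl fun j _ => ?_
    rw [integral_const_mul, integral_weight_term, Finset.mul_sum, Finset.mul_sum, Finset.mul_sum]
    refine Finset.sum_congr rfl fun a _ => ?_
    rw [G_inl_apply_eq hΓ]
    -- A message that does not enter coordinate `c` has no dependence on it in the own block.
    have hs : share c j * Γ.lagMatrix j (j, a) c = Γ.lagMatrix j (j, a) c := by
      rcases c with q | s
      · simp [share]
      · by_cases hs : s.1 = j <;> simp [share, lagMatrix, hs]
    linear_combination (2 * p j (j, a)) * hs
  have h2 : ∫ u : Directions d m, Sum.elim (fun q => (2 * ∑ s, ρ s * (Γ.A s.1 s.2 ⬝ᵥ u.2)) * u.2 q)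
      (fun _ => 0) c ∂(directionLaw d m) = 2 * ∑ s, Γ.G (.inr s) c * ρ s := by
    rcases c with q | s
    · have e : ∀ u : Directions d m, (2 * ∑ s, ρ s * (Γ.A s.1 s.2 ⬝ᵥ u.2)) * u.2 q
          = ∑ s, (2 * ρ s) * ((Γ.A s.1 s.2 ⬝ᵥ u.2) * u.2 q) := by
        intro u
        rw [Finset.mul_sum, Finset.sum_mul]
        exact Finset.sum_congr rfl fun s _ => by ring
      simp only [Sum.elim_inl, e]
      rw [integral_finsetSum _ fun s _ => HasAllMoments.integrable <| HasAllMoments.const_mul _ <|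
        (hasAllMoments_dotProduct_snd _).mul (hasAllMoments_snd q), Finset.mul_sum]
      refine Finset.sum_congr rfl fun s _ => ?_
      have h3 : ∫ u : Directions d m, (Γ.A s.1 s.2 ⬝ᵥ u.2) * u.2 q ∂(directionLaw d m)
          = Γ.A s.1 s.2 q := by
        have h4 := integral_prod_mul (μ := stdNormal (JointIndex d m))
          (ν := stdNormal (Fin n × Fin d)) (fun _ => (1 : ℝ))
          (fun y => (Γ.A s.1 s.2 ⬝ᵥ y) * y q)
        simpa [integral_dotProduct_mul_eval] using h4
      rw [integral_const_mul, h3]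
      simp [G]
      ring
    · simp [G]
  have hi1 := HasAllMoments.integrable (HasAllMoments.sum Finset.univ fun j => HasAllMoments.mul
    ((((hasAllMoments_weight j).mul (hasAllMoments_dotProduct_snd (p j))).mul
      (Γ.hasAllMoments_bilinear j)).const_mul (share c j)) (hasAllMoments_fst c))
  have hi2 : Integrable (fun u : Directions d m => Sum.elim
      (fun q => (2 * ∑ s, ρ s * (Γ.A s.1 s.2 ⬝ᵥ u.2)) * u.2 q) (fun _ => 0) c)
      (directionLaw d m) := by
    rcases c with q | s
    · exact (((HasAllMoments.sum _ fun s =>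
        (hasAllMoments_dotProduct_snd _).const_mul _).const_mul 2).mul
          (hasAllMoments_snd q)).integrable
    · exact (HasAllMoments.const 0).integrable
  simp only [linEst]
  rw [integral_add hi1 hi2, h1, h2, Fintype.sum_sum_type, ← mul_add]
  rfl

/-- The remainder of the gradient estimate is odd in `[ξ, ν]`, hence centered. -/
lemma integral_quadEst (δ : ℝ) (c : JointIndex d m) :
    ∫ u, Γ.quadEst δ c u ∂(directionLaw d m) = 0 := by
  have e : ∀ u : Directions d m, Γ.quadEst δ c u = ∑ j, ∑ f, ∑ f', share c j * (δ / 2) *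
      ((u.1 f * u.1 f' * u.1 c) * (weight j u.2 * ((fun q => Γ.lagMatrix j q f) ⬝ᵥ u.2)
        * ((fun q => Γ.lagMatrix j q f') ⬝ᵥ u.2))) := by
    intro u
    rw [quadEst]
    refine Finset.sum_congr rfl fun j _ => ?_
    rw [bilinear_eq_sum, sq, Finset.sum_mul_sum]
    simp only [Finset.mul_sum, Finset.sum_mul]
    exact Finset.sum_congr rfl fun f _ => Finset.sum_congr rfl fun f' _ => by ring
  have hi : ∀ j f f', Integrable (fun u : Directions d m => share c j * (δ / 2) *
      ((u.1 f * u.1 f' * u.1 c) * (weight j u.2 * ((fun q => Γ.lagMatrix j q f) ⬝ᵥ u.2)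
        * ((fun q => Γ.lagMatrix j q f') ⬝ᵥ u.2)))) (directionLaw d m) := fun j f f' =>
    HasAllMoments.integrable <| HasAllMoments.const_mul _ <|
      (((hasAllMoments_fst f).mul (hasAllMoments_fst f')).mul (hasAllMoments_fst c)).mul
        (((hasAllMoments_weight j).mul (hasAllMoments_dotProduct_snd _)).mul
          (hasAllMoments_dotProduct_snd _))
  simp_rw [e]
  rw [integral_finsetSum _ fun j _ => integrable_finsetSum _ fun f _ =>
    integrable_finsetSum _ fun f' _ => hi j f f']
  refine Finset.sum_eq_zero fun j _ => ?_
  rw [integral_finsetSum _ fun f _ => integrable_finsetSum _ fun f' _ => hi j f f']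
  refine Finset.sum_eq_zero fun f _ => ?_
  rw [integral_finsetSum _ fun f' _ => hi j f f']
  refine Finset.sum_eq_zero fun f' _ => ?_
  rw [integral_const_mul, integral_prod_mul (fun θ : JointIndex d m → ℝ => θ f * θ f' * θ c)
    (fun y => weight j y * ((fun q => Γ.lagMatrix j q f) ⬝ᵥ y)
      * ((fun q => Γ.lagMatrix j q f') ⬝ᵥ y)), integral_mul_mul_eval]
  simp

end QuadGame

/-! ### The Gaussian directions -/

/-- The time at which a direction is drawn. -/
def NoiseLabel.time {n : ℕ} : NoiseLabel n → ℕ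
  | .xi t _ => t
  | .nu t _ => t
  | .eta t _ => t

section Noise

variable {n d : ℕ} {m : Fin n → ℕ} {Ω : Type*} [mΩ : MeasurableSpace Ω]
  (w : ∀ a : NoiseLabel n, Ω → EuclideanSpace ℝ (Fin (a.dim d m))) {P : Measure Ω}

/-- The coordinates of all the directions drawn at time `t`. -/
def stepDirections (t : ℕ) (ω : Ω) : Directions d m :=
  (QuadGame.joint (fun j => w (.xi t j) ω) (fun j => w (.nu t j) ω), flat fun j => w (.eta t j) ω)

/-- Where a coordinate of the directions of time `t` is found among the coordinates of all
directions. -/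
def stepCoord (t : ℕ) : JointIndex d m ⊕ (Fin n × Fin d) → Σ a : NoiseLabel n, Fin (a.dim d m)
  | .inl (.inl p) => ⟨.xi t p.1, p.2⟩
  | .inl (.inr s) => ⟨.nu t s.1, s.2⟩
  | .inr p => ⟨.eta t p.1, p.2⟩

lemma stepCoord_injective (t : ℕ) :
    Function.Injective (stepCoord t : JointIndex d m ⊕ (Fin n × Fin d) → _) := by
  rintro ((⟨i, a⟩ | ⟨i, a⟩) | ⟨i, a⟩) ((⟨j, b⟩ | ⟨j, b⟩) | ⟨j, b⟩) h <;> cases h <;> rfl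

variable {w}

lemma IsGaussianNoise.map_ofLp (hw : IsGaussianNoise w P) (a : NoiseLabel n)
    (hm : Measurable (w a)) :
    P.map (fun ω => (w a ω).ofLp) = stdNormal (Fin (a.dim d m)) := by
  have h1 : P.map (fun ω => (w a ω).ofLp) = (P.map (w a)).map WithLp.ofLp :=
    (Measure.map_map (WithLp.measurable_ofLp 2 _) hm).symm
  rw [h1, (hw.law a).map_eq, ← map_pi_eq_stdGaussian,
    Measure.map_map (WithLp.measurable_ofLp 2 _) (WithLp.measurable_toLp 2 _)]
  exact Measure.map_id

lemma measurable_coord (hm : ∀ a, Measurable (w a)) (a : NoiseLabel n) (k : Fin (a.dim d m)) :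
    Measurable fun ω => w a ω k :=
  (measurable_pi_apply k).comp ((WithLp.measurable_ofLp 2 _).comp (hm a))

lemma IsGaussianNoise.map_coord (hw : IsGaussianNoise w P) (hm : ∀ a, Measurable (w a))
    (a : NoiseLabel n) (k : Fin (a.dim d m)) : P.map (fun ω => w a ω k) = gaussianReal 0 1 := by
  have h1 : P.map (fun ω => w a ω k)
      = (P.map fun ω => (w a ω).ofLp).map fun x : Fin (a.dim d m) → ℝ => x k :=
    (Measure.map_map (measurable_pi_apply k) ((WithLp.measurable_ofLp 2 _).comp (hm a))).symm
  rw [h1, hw.map_ofLp a (hm a)]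
  exact (measurePreserving_eval (fun _ => gaussianReal 0 1) k).map_eq

variable [IsProbabilityMeasure P]

/-- All the coordinates of all the directions are jointly independent. -/
lemma IsGaussianNoise.iIndepFun_coord (hw : IsGaussianNoise w P) (hm : ∀ a, Measurable (w a)) :
    iIndepFun (fun (p : Σ a : NoiseLabel n, Fin (a.dim d m)) ω => w p.1 ω p.2) P := by
  refine iIndepFun_uncurry (X := fun a k ω => w a ω k) (fun a k => measurable_coord hm a k)
    (hw.indep.comp (fun a => WithLp.ofLp) fun a => WithLp.measurable_ofLp 2 _) fun a => ?_
  rw [iIndepFun_iff_map_fun_eq_pi_map fun k => (measurable_coord hm a k).aemeasurable]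
  simp_rw [hw.map_coord hm a]
  exact hw.map_ofLp a (hm a)

lemma IsGaussianNoise.measurePreserving_stepDirections (hw : IsGaussianNoise w P)
    (hm : ∀ a, Measurable (w a)) (t : ℕ) :
    MeasurePreserving (stepDirections w t) P (directionLaw d m) := by
  have hY : MeasurePreserving (fun ω (k : JointIndex d m ⊕ (Fin n × Fin d)) =>
      w (stepCoord t k).1 ω (stepCoord t k).2) P (stdNormal _) := by
    refine ⟨measurable_pi_lambda _ fun k => measurable_coord hm _ _, ?_⟩
    have h1 := ((hw.iIndepFun_coord hm).precomp (stepCoord_injective t)).map_fun_eq_pi_map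
      fun k => (measurable_coord hm _ _).aemeasurable
    simp_rw [hw.map_coord hm] at h1
    exact h1
  have h2 := (measurePreserving_sumPiEquivProdPi
    (fun _ : JointIndex d m ⊕ (Fin n × Fin d) => gaussianReal 0 1)).comp hY
  convert! h2 using 1
  funext ω
  refine Prod.ext (funext fun k => ?_) (funext fun k => ?_)
  · rcases k with p | s <;> rfl
  · rfl

omit [IsProbabilityMeasure P] in
lemma integral_comp_of_measurePreserving {α : Type*} [MeasurableSpace α] {μ : Measure α} {X : Ω → α}
    (hX : MeasurePreserving X P μ) {f : α → ℝ} (hf : Measurable f) :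
    ∫ ω, f (X ω) ∂P = ∫ u, f u ∂μ := by
  rw [← hX.map_eq, integral_map hX.measurable.aemeasurable hf.aestronglyMeasurable]

/-- The σ-algebra of the directions drawn at the times in `T`. -/
abbrev directionAlgebra (w : ∀ a : NoiseLabel n, Ω → EuclideanSpace ℝ (Fin (a.dim d m)))
    (T : Set ℕ) : MeasurableSpace Ω :=
  ⨆ a ∈ {a : NoiseLabel n | a.time ∈ T}, MeasurableSpace.comap (w a) inferInstance

omit mΩ in
lemma directionAlgebra_mono {S T : Set ℕ} (h : S ⊆ T) :
    directionAlgebra w S ≤ directionAlgebra w T :=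
  biSup_mono fun _ ha => h ha

lemma directionAlgebra_le (hm : ∀ a, Measurable (w a)) (T : Set ℕ) : directionAlgebra w T ≤ mΩ :=
  iSup₂_le fun a _ => (hm a).comap_le

omit [IsProbabilityMeasure P] in
lemma IsGaussianNoise.indep_directionAlgebra (hw : IsGaussianNoise w P)
    (hm : ∀ a, Measurable (w a)) {S T : Set ℕ} (h : Disjoint S T) :
    Indep (directionAlgebra w S) (directionAlgebra w T) P :=
  indep_iSup_of_disjoint (fun a => (hm a).comap_le) hw.indep.iIndep
    (Set.disjoint_left.2 fun _ ha hb => Set.disjoint_left.1 h ha hb)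

/-- The filtration of the directions drawn up to time `t`. -/
def directionFiltration (w : ∀ a : NoiseLabel n, Ω → EuclideanSpace ℝ (Fin (a.dim d m)))
    (hm : ∀ a, Measurable (w a)) : Filtration ℕ mΩ where
  seq t := directionAlgebra w (Set.Iic t)
  mono' _ _ h := directionAlgebra_mono (Set.Iic_subset_Iic.2 h)
  le' _ := directionAlgebra_le hm _

omit mΩ in
lemma measurable_stepDirections (t : ℕ) :
    Measurable[directionAlgebra w {t}] (stepDirections w t) := by
  have hc : ∀ (a : NoiseLabel n) (k : Fin (a.dim d m)), a.time = t →
      Measurable[directionAlgebra w {t}] fun ω => w a ω k := by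
    intro a k ha
    have h1 : Measurable[directionAlgebra w {t}] (w a) :=
      measurable_iff_comap_le.2 (le_biSup (fun a => MeasurableSpace.comap (w a) inferInstance)
        (show a ∈ {a : NoiseLabel n | a.time ∈ ({t} : Set ℕ)} from ha))
    exact (measurable_pi_apply k).comp ((WithLp.measurable_ofLp 2 _).comp h1)
  refine Measurable.prodMk ?_ ?_
  · refine @measurable_pi_lambda _ _ _ (directionAlgebra w {t}) _ _ fun k => ?_
    rcases k with p | s
    · exact hc (.xi t p.1) p.2 rfl
    · exact hc (.nu t s.1) s.2 rfl
  · exact @measurable_pi_lambda _ _ _ (directionAlgebra w {t}) _ _ fun p => hc (.eta t p.1) p.2 rfl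

end Noise

/-! ### The iterates as a linear random recursion -/

section Run

variable {n d : ℕ} {m : Fin n → ℕ} {Γ : QuadGame n d m} {Ω : Type*} [mΩ : MeasurableSpace Ω]
  {P : Measure Ω} [IsProbabilityMeasure P]
  {w : ∀ a : NoiseLabel n, Ω → EuclideanSpace ℝ (Fin (a.dim d m))}
  {σ δ g : ℝ} {x₀ : Action n d} {l₀ : DualVars m} {x : ℕ → Ω → Action n d}
  {l : ℕ → Ω → DualVars m}

/-- Centered at a zero `z*` of the gap function, the iterates follow a linear recursion with
independent Gaussian-polynomial coefficients of mean `0` and `2 Gᵀ G`. The index is shifted so that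
the recursion starts at `0`. -/
lemma IsZeroOrderRun.exists_isLinearRecursion (hΓ : Γ.Standing) (hw : IsGaussianNoise w P)
    (hm : ∀ a, Measurable (w a)) (hσ : 0 < σ) (hδ : 0 < δ)
    (hrun : IsZeroOrderRun Γ σ δ (fun t => g / (t : ℝ)) w x₀ l₀ x l)
    {xs : Action n d} {ls : DualVars m} (hz : Γ.G *ᵥ QuadGame.joint xs ls + Γ.offset = 0) :
    ∃ K s R, IsLinearRecursion P (directionFiltration w hm)
      (fun t => directionAlgebra w {t + 1}) (2 • (Γ.Gᵀ * Γ.G)) K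
      (fun t => g / ((t : ℝ) + 1)) s R
      (fun t ω => QuadGame.joint (x (t + 1) ω) (l (t + 1) ω) - QuadGame.joint xs ls) := by
  set z := QuadGame.joint xs ls with hz_def
  set p : Fin n → Fin n × Fin d → ℝ := fun j => Γ.lagMatrix j *ᵥ z + Γ.r j with hp
  set pc : JointIndex d m → Fin n → Fin n × Fin d → ℝ :=
    fun b j q => Γ.lagMatrix j q b with hpc
  set ρc : JointIndex d m → (Σ i, Fin (m i)) → ℝ := fun b s => Γ.G (.inr s) b with hρc
  set s₀ : JointIndex d m → Directions d m → ℝ :=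
    fun a u => Γ.linEst p 0 a u + Γ.quadEst δ a u with hs₀
  set R₀ : JointIndex d m → JointIndex d m → Directions d m → ℝ :=
    fun a b u => Γ.linEst (pc b) (ρc b) a u with hR₀
  have hs₀m : ∀ a, Measurable (s₀ a) := fun a =>
    (Γ.measurable_linEst _ _ _).add (Γ.measurable_quadEst _ _)
  have hR₀m : ∀ a b, Measurable (R₀ a b) := fun a b => Γ.measurable_linEst _ _ _
  have hs₀M : ∀ a, HasAllMoments (s₀ a) (directionLaw d m) := fun a =>
    (Γ.hasAllMoments_linEst _ _ _).add (Γ.hasAllMoments_quadEst _ _)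
  have hR₀M : ∀ a b, HasAllMoments (R₀ a b) (directionLaw d m) := fun a b =>
    Γ.hasAllMoments_linEst _ _ _
  have hmp := fun t => hw.measurePreserving_stepDirections hm (t + 1)
  set M : Matrix (JointIndex d m) (JointIndex d m) ℝ := 2 • (Γ.Gᵀ * Γ.G) with hM
  set K₁ : JointIndex d m → ℝ := fun a => ∫ u, s₀ a u ^ 2 ∂(directionLaw d m) with hK₁
  set K₂ : JointIndex d m × JointIndex d m → ℝ :=
    fun ab => ∫ u, (R₀ ab.1 ab.2 u - M ab.1 ab.2) ^ 2 ∂(directionLaw d m) with hK₂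
  have hK₁0 : ∀ a ∈ Finset.univ, 0 ≤ K₁ a := fun a _ => integral_nonneg fun u => sq_nonneg _
  have hK₂0 : ∀ a ∈ Finset.univ, 0 ≤ K₂ a := fun a _ => integral_nonneg fun u => sq_nonneg _
  refine ⟨∑ a, K₁ a + ∑ ab, K₂ ab, fun t a ω => s₀ a (stepDirections w (t + 1) ω),
    fun t a b ω => R₀ a b (stepDirections w (t + 1) ω), ?_⟩
  refine
    { indep := fun t => hw.indep_directionAlgebra hm ?_
      le_succ := fun t => directionAlgebra_mono ?_
      measurable_s := fun t a => (hs₀m a).comp (measurable_stepDirections (t + 1))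
      measurable_R := fun t a b => (hR₀m a b).comp (measurable_stepDirections (t + 1))
      memLp_s := fun t a => (hs₀M a).memLp_two.comp_measurePreserving (hmp t)
      memLp_R := fun t a b => (hR₀M a b).memLp_two.comp_measurePreserving (hmp t)
      integral_s := fun t a => ?_
      integral_R := fun t a b => ?_
      sq_s_le := fun t a => ?_
      sq_R_le := fun t a b => ?_
      init := ⟨QuadGame.joint x₀ l₀ - z, fun ω => by rw [zero_add, hrun.init_x, hrun.init_l]⟩
      step := fun t ω a => ?_ }
  · simp
  · simp
  · rw [integral_comp_of_measurePreserving (hmp t) (hs₀m a)]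
    simp only [hs₀]
    rw [integral_add (Γ.hasAllMoments_linEst _ _ _).integrable
      (Γ.hasAllMoments_quadEst _ _).integrable, Γ.integral_quadEst, add_zero, hΓ.integral_linEst,
      Finset.sum_eq_zero, mul_zero]
    intro f _
    rcases f with ⟨j, b⟩ | f
    · have h1 : p j (j, b) = (Γ.G *ᵥ z + Γ.offset) (.inl (j, b)) := by
        simp only [hp, Pi.add_apply, Matrix.mulVec, dotProduct, QuadGame.G_inl_apply_eq hΓ]
        rfl
      have h2 : p j (j, b) = 0 := by rw [h1, hz]; rfl
      simp [h2]
    · simp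
  · rw [integral_comp_of_measurePreserving (hmp t) (hR₀m a b)]
    simp only [hR₀]
    rw [hΓ.integral_linEst, hM, Matrix.smul_apply, Matrix.mul_apply, nsmul_eq_mul]
    congr 1
    refine Finset.sum_congr rfl fun f _ => ?_
    rw [Matrix.transpose_apply]
    congr 1
    rcases f with ⟨j, c⟩ | f
    · simp [hpc, QuadGame.G_inl_apply_eq hΓ]
    · rfl
  · rw [integral_comp_of_measurePreserving (hmp t) ((hs₀m a).pow_const 2)]
    have := Finset.single_le_sum hK₁0 (Finset.mem_univ a)
    have h2 := Finset.sum_nonneg hK₂0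
    simp only [hK₁] at this ⊢
    linarith
  · rw [integral_comp_of_measurePreserving (hmp t)
      (((hR₀m a b).sub_const (M a b)).pow_const 2)]
    have := Finset.single_le_sum hK₂0 (Finset.mem_univ (a, b))
    have h2 := Finset.sum_nonneg hK₁0
    simp only [hK₂] at this ⊢
    linarith
  · set v := QuadGame.joint (x (t + 1) ω) (l (t + 1) ω) - z with hv
    have hzv : QuadGame.joint (x (t + 1) ω) (l (t + 1) ω) = z + v := by rw [hv]; abel
    obtain ⟨ξ, hξ⟩ : ∃ ξ : Action n d, ξ = fun j => w (.xi (t + 1) j) ω := ⟨_, rfl⟩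
    obtain ⟨ν, hν⟩ : ∃ ν : DualVars m, ν = fun j => w (.nu (t + 1) j) ω := ⟨_, rfl⟩
    obtain ⟨η, hη⟩ : ∃ η : Action n d, η = fun j => w (.eta (t + 1) j) ω := ⟨_, rfl⟩
    have hdir : stepDirections w (t + 1) ω = (QuadGame.joint ξ ν, flat η) := by rw [hξ, hν, hη]; rfl
    have h1 : QuadGame.joint (x (t + 1 + 1) ω) (l (t + 1 + 1) ω) a
        = QuadGame.joint (x (t + 1) ω) (l (t + 1) ω) a - g / ((t : ℝ) + 1) *
          QuadGame.joint (Γ.zetaX σ δ (x (t + 1) ω) (l (t + 1) ω) ξ ν η)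
            (Γ.zetaDual σ δ (x (t + 1) ω) (l (t + 1) ω) ξ ν η) a := by
      rw [hξ, hν, hη]
      rcases a with q | q
      · simp [QuadGame.joint, flat, hrun.step_x (t + 1) (by omega) ω]
      · simp [QuadGame.joint, hrun.step_l (t + 1) (by omega) ω]
    have hP : (fun j => Γ.lagMatrix j *ᵥ (z + v) + Γ.r j) = p + ∑ b, v b • pc b := by
      funext j q
      simp only [hp, Matrix.mulVec_add, Pi.add_apply, Finset.sum_apply, Pi.smul_apply, smul_eq_mul,
        hpc]
      have : (Γ.lagMatrix j *ᵥ v) q = ∑ b, v b * Γ.lagMatrix j q b :=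
        Finset.sum_congr rfl fun b _ => mul_comm _ _
      rw [this]; ring
    have hρ : (fun s : Σ i, Fin (m i) => Γ.residual s.1 (x (t + 1) ω) s.2)
        = (0 : (Σ i, Fin (m i)) → ℝ) + ∑ b, v b • ρc b := by
      funext s
      have h2 : Γ.residual s.1 (x (t + 1) ω) s.2 = ((Γ.G *ᵥ z + Γ.offset) + Γ.G *ᵥ v) (.inr s) := by
        rw [add_right_comm, ← Matrix.mulVec_add, ← hzv]
        exact (Γ.G_mulVec_inr _ _ s.1 s.2).symm
      rw [h2, hz, zero_add, zero_add]
      simp only [Finset.sum_apply, Pi.smul_apply, smul_eq_mul, hρc]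
      exact Finset.sum_congr rfl fun b _ => mul_comm _ _
    rw [Pi.sub_apply, h1, hΓ.joint_zeta_eq hσ hδ, hzv, hP, hρ, Γ.linEst_add_sum]
    simp only [hs₀, hR₀, hdir, Pi.add_apply]
    ring

/-- The actions that belong to a joint vector. -/
def actionOf (z : JointIndex d m → ℝ) : Action n d :=
  fun i => WithLp.toLp 2 fun a => z (.inl (i, a))

/-- The dual variables that belong to a joint vector. -/
def dualOf (z : JointIndex d m → ℝ) : DualVars m :=
  fun i => WithLp.toLp 2 fun k => z (.inr ⟨i, k⟩)

lemma joint_actionOf_dualOf (z : JointIndex d m → ℝ) :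
    QuadGame.joint (actionOf z) (dualOf z) = z := by
  funext s
  rcases s with p | s <;> rfl

lemma continuous_actionOf : Continuous (actionOf : (JointIndex d m → ℝ) → Action n d) :=
  continuous_pi fun _ => (PiLp.continuous_toLp 2 _).comp
    (continuous_pi fun _ => continuous_apply _)

/-- The conclusions of the convergence theorem for directions that are measurable functions. -/
lemma IsZeroOrderRun.convergence (hΓ : Γ.Standing) (hGNE : ∃ x, Γ.IsGNE x)
    (hw : IsGaussianNoise w P) (hm : ∀ a, Measurable (w a)) (hσ : 0 < σ) (hδ : 0 < δ)
    (hg : 1 / Γ.muF < g)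
    (hrun : IsZeroOrderRun Γ σ δ (fun t => g / (t : ℝ)) w x₀ l₀ x l) :
    (∀ t, Measurable (x (t + 1))) ∧
    (∀ᵐ ω ∂P, ∃ v, Γ.IsGNE v ∧ Tendsto (fun t => x (t + 1) ω) atTop (𝓝 v)) ∧
    (∀ t, Integrable (fun ω => Γ.gap (x (t + 1) ω) (l (t + 1) ω)) P) ∧
    ∃ B, 0 ≤ B ∧ ∀ t : ℕ, ∫ ω, Γ.gap (x (t + 1) ω) (l (t + 1) ω) ∂P ≤ B / ((t : ℝ) + 1) := by
  obtain ⟨xs, hxs⟩ := hGNE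
  obtain ⟨ls, hz⟩ := hΓ.exists_multipliers hxs
  obtain ⟨ρ, hρg, hρ⟩ := Γ.exists_pl_constant hg
  have hg0 : 0 < g := lt_of_le_of_lt (by unfold QuadGame.muF; positivity) hg
  obtain ⟨K, s, R, h⟩ := hrun.exists_isLinearRecursion hΓ hw hm hσ hδ hz
  set z := QuadGame.joint xs ls with hz_def
  have hx : ∀ t ω, x (t + 1) ω
      = actionOf ((QuadGame.joint (x (t + 1) ω) (l (t + 1) ω) - z) + z) := by
    intro t ω
    rw [sub_add_cancel]
    rfl
  have hgap : ∀ t ω, Γ.gap (x (t + 1) ω) (l (t + 1) ω)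
      = (Γ.G *ᵥ (QuadGame.joint (x (t + 1) ω) (l (t + 1) ω) - z))
        ⬝ᵥ (Γ.G *ᵥ (QuadGame.joint (x (t + 1) ω) (l (t + 1) ω) - z)) := by
    intro t ω
    rw [Γ.gap_eq, Matrix.mulVec_sub, ← neg_eq_of_add_eq_zero_right hz, sub_eq_add_neg]
  simp_rw [hgap]
  refine ⟨fun t => ?_, ?_, fun t => h.integrable_quadratic Γ.G t, h.exists_gap_le hg0 hρ hρg⟩
  · have hD : Measurable fun ω => QuadGame.joint (x (t + 1) ω) (l (t + 1) ω) - z :=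
      measurable_pi_lambda _ fun a =>
        (h.measurable t a).mono ((directionFiltration w hm).le t) le_rfl
    have : x (t + 1) = fun ω => actionOf ((QuadGame.joint (x (t + 1) ω) (l (t + 1) ω) - z) + z) :=
      funext (hx t)
    rw [this]
    exact continuous_actionOf.measurable.comp (hD.add_const z)
  · filter_upwards [h.ae_exists_tendsto hg0 hρ hρg] with ω hω
    obtain ⟨v, hv, hGv⟩ := hω
    refine ⟨actionOf (v + z), hΓ.isGNE_of_eq_zero (l := dualOf (v + z)) ?_, ?_⟩
    · rw [joint_actionOf_dualOf, Matrix.mulVec_add, hGv, zero_add, hz]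
    · exact ((continuous_actionOf.tendsto _).comp (hv.add_const z)).congr fun t => (hx t ω).symm

/-- The iterates driven by given directions; the index is shifted by one. -/
noncomputable def runFrom (Γ : QuadGame n d m) (σ δ : ℝ) (γ : ℕ → ℝ)
    (w : ∀ a : NoiseLabel n, Ω → EuclideanSpace ℝ (Fin (a.dim d m))) (x₀ : Action n d)
    (l₀ : DualVars m) (ω : Ω) : ℕ → Action n d × DualVars m
  | 0 => (x₀, l₀)
  | t + 1 =>
    let z := runFrom Γ σ δ γ w x₀ l₀ ω t
    (fun i => z.1 i - γ (t + 1) • Γ.zetaX σ δ z.1 z.2 (fun j => w (.xi (t + 1) j) ω)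
        (fun j => w (.nu (t + 1) j) ω) (fun j => w (.eta (t + 1) j) ω) i,
      fun i => z.2 i - γ (t + 1) • Γ.zetaDual σ δ z.1 z.2 (fun j => w (.xi (t + 1) j) ω)
        (fun j => w (.nu (t + 1) j) ω) (fun j => w (.eta (t + 1) j) ω) i)

omit mΩ in
lemma isZeroOrderRun_runFrom (Γ : QuadGame n d m) (σ δ : ℝ) (γ : ℕ → ℝ)
    (w : ∀ a : NoiseLabel n, Ω → EuclideanSpace ℝ (Fin (a.dim d m))) (x₀ : Action n d)
    (l₀ : DualVars m) :
    IsZeroOrderRun Γ σ δ γ w x₀ l₀ (fun t ω => (runFrom Γ σ δ γ w x₀ l₀ ω (t - 1)).1)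
      (fun t ω => (runFrom Γ σ δ γ w x₀ l₀ ω (t - 1)).2) where
  init_x _ := rfl
  init_l _ := rfl
  step_x t ht ω i := by
    obtain ⟨t, rfl⟩ := Nat.exists_eq_add_of_le' ht
    rfl
  step_l t ht ω i := by
    obtain ⟨t, rfl⟩ := Nat.exists_eq_add_of_le' ht
    rfl

omit mΩ in
/-- The directions determine the iterates from time `1` on. -/
lemma IsZeroOrderRun.eq_of_forall_eq {γ : ℕ → ℝ}
    {w' : ∀ a : NoiseLabel n, Ω → EuclideanSpace ℝ (Fin (a.dim d m))}
    {x' : ℕ → Ω → Action n d} {l' : ℕ → Ω → DualVars m}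
    (h : IsZeroOrderRun Γ σ δ γ w x₀ l₀ x l) (h' : IsZeroOrderRun Γ σ δ γ w' x₀ l₀ x' l') {ω : Ω}
    (hω : ∀ a, w a ω = w' a ω) (t : ℕ) :
    x (t + 1) ω = x' (t + 1) ω ∧ l (t + 1) ω = l' (t + 1) ω := by
  induction t with
  | zero => exact ⟨(h.init_x ω).trans (h'.init_x ω).symm, (h.init_l ω).trans (h'.init_l ω).symm⟩
  | succ t ih =>
    refine ⟨funext fun i => ?_, funext fun i => ?_⟩
    · rw [h.step_x _ (by omega), h'.step_x _ (by omega), ih.1, ih.2]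
      simp only [hω]
    · rw [h.step_l _ (by omega), h'.step_l _ (by omega), ih.1, ih.2]
      simp only [hω]

end Run

end ZeroOrderGNE

open ZeroOrderGNE in
theorem theorem1 {n d : ℕ} {m : Fin n → ℕ} (Γ : QuadGame n d m)
    (hΓ : Γ.Standing) (hGNE : ∃ x, Γ.IsGNE x)
    {Ω : Type*} [MeasurableSpace Ω] (P : Measure Ω) [IsProbabilityMeasure P]
    (w : ∀ a : NoiseLabel n, Ω → EuclideanSpace ℝ (Fin (a.dim d m)))
    (hw : IsGaussianNoise w P)
    (σ δ g : ℝ) (hσ : 0 < σ) (hδ : 0 < δ) (hg : 1 / Γ.muF < g)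
    (x₀ : Action n d) (l₀ : DualVars m)
    (x : ℕ → Ω → Action n d) (l : ℕ → Ω → DualVars m)
    (hrun : IsZeroOrderRun Γ σ δ (fun t => g / (t : ℝ)) w x₀ l₀ x l) :
    (∃ xlim : Ω → Action n d, Measurable xlim ∧
      ∀ᵐ ω ∂P, Γ.IsGNE (xlim ω) ∧ Tendsto (fun t => x t ω) atTop (𝓝 (xlim ω))) ∧
    (∀ t, 1 ≤ t → Integrable (fun ω => Γ.gap (x t ω) (l t ω)) P) ∧
    Tendsto (fun t => ∫ ω, Γ.gap (x t ω) (l t ω) ∂P) atTop (𝓝 0) ∧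
    (fun t => ∫ ω, Γ.gap (x t ω) (l t ω) ∂P) =O[atTop] (fun t : ℕ => 1 / (t : ℝ)) := by
  -- The directions are only almost everywhere measurable: pass to measurable versions.
  set w' : ∀ a : NoiseLabel n, Ω → EuclideanSpace ℝ (Fin (a.dim d m)) :=
    fun a => (hw.law a).aemeasurable.mk (w a) with hw'_def
  have hm : ∀ a, Measurable (w' a) := fun a => (hw.law a).aemeasurable.measurable_mk
  have hae : ∀ a, w a =ᵐ[P] w' a := fun a => (hw.law a).aemeasurable.ae_eq_mk
  have hw' : IsGaussianNoise w' P :=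
    ⟨fun a => (hw.law a).congr (hae a).symm, (iIndepFun_congr hae).1 hw.indep⟩
  have hrun' := isZeroOrderRun_runFrom Γ σ δ (fun t => g / (t : ℝ)) w' x₀ l₀
  set x' : ℕ → Ω → Action n d :=
    fun t ω => (runFrom Γ σ δ (fun t => g / (t : ℝ)) w' x₀ l₀ ω (t - 1)).1
  set l' : ℕ → Ω → DualVars m :=
    fun t ω => (runFrom Γ σ δ (fun t => g / (t : ℝ)) w' x₀ l₀ ω (t - 1)).2
  have heq : ∀ᵐ ω ∂P, ∀ t, x (t + 1) ω = x' (t + 1) ω ∧ l (t + 1) ω = l' (t + 1) ω := by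
    have h1 : ∀ᵐ ω ∂P, ∀ (t : ℕ) (i : Fin n), w (.xi t i) ω = w' (.xi t i) ω
        ∧ w (.nu t i) ω = w' (.nu t i) ω ∧ w (.eta t i) ω = w' (.eta t i) ω :=
      ae_all_iff.2 fun t => ae_all_iff.2 fun i =>
        (hae (.xi t i)).and ((hae (.nu t i)).and (hae (.eta t i)))
    filter_upwards [h1] with ω hω
    refine fun t => hrun.eq_of_forall_eq hrun' (fun a => ?_) t
    rcases a with ⟨t, i⟩ | ⟨t, i⟩ | ⟨t, i⟩
    exacts [(hω t i).1, (hω t i).2.1, (hω t i).2.2]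
  obtain ⟨hmeas, hconv, hint, B, hB0, hB⟩ := hrun'.convergence hΓ hGNE hw' hm hσ hδ hg
  have hgap : ∀ t, (fun ω => Γ.gap (x (t + 1) ω) (l (t + 1) ω))
      =ᵐ[P] fun ω => Γ.gap (x' (t + 1) ω) (l' (t + 1) ω) := by
    intro t
    filter_upwards [heq] with ω hω
    rw [(hω t).1, (hω t).2]
  have hnonneg : ∀ t, 0 ≤ ∫ ω, Γ.gap (x t ω) (l t ω) ∂P := fun t => integral_nonneg fun ω => by
    rw [Γ.gap_eq]
    exact real_dotProduct_self_nonneg _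
  have hle : ∀ t : ℕ, 1 ≤ t → ∫ ω, Γ.gap (x t ω) (l t ω) ∂P ≤ B * (1 / (t : ℝ)) := by
    intro t ht
    obtain ⟨t, rfl⟩ := Nat.exists_eq_add_of_le' ht
    rw [integral_congr_ae (hgap t), mul_one_div]
    push_cast
    exact hB t
  have hO : (fun t => ∫ ω, Γ.gap (x t ω) (l t ω) ∂P) =O[atTop] (fun t : ℕ => 1 / (t : ℝ)) := by
    refine IsBigO.of_bound B ?_
    filter_upwards [eventually_ge_atTop 1] with t ht
    rw [Real.norm_of_nonneg (hnonneg t), Real.norm_of_nonneg (by positivity)]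
    exact hle t ht
  refine ⟨?_, fun t ht => ?_, hO.trans_tendsto tendsto_one_div_atTop_nhds_zero_nat, hO⟩
  · obtain ⟨xlim, hxm, hxlim⟩ := measurable_limit_of_tendsto_metrizable_ae
      (μ := P) (L := atTop) (fun t => (hmeas t).aemeasurable)
      (hconv.mono fun ω ⟨v, _, hv⟩ => ⟨v, hv⟩)
    refine ⟨xlim, hxm, ?_⟩
    filter_upwards [hconv, hxlim, heq] with ω ⟨v, hv, hvt⟩ hω hωeq
    rw [← tendsto_nhds_unique hvt hω]
    refine ⟨hv, (tendsto_add_atTop_iff_nat 1).1 (hvt.congr fun t => (hωeq t).1.symm)⟩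
  · obtain ⟨t, rfl⟩ := Nat.exists_eq_add_of_le' ht
    exact (hint t).congr (hgap t).symm
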